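/- Let $n\ge 1$, let $\Omega\subset\mathbb R^n$ be a bounded Lipschitz domain with surface measure $\sigma$ on $\partial\Omega$ and unit outward normal $\nu$, and let $s\in(0,1)$. Let $\mathcal B$ be one of the boundary operators $\mathcal B(u)=u$ (Dirichlet), $\mathcal B(u)=\partial u/\partial\nu$ (Neumann), or $\mathcal B(u)=\kappa u+\partial u/\partial\nu$ (Robin), with $\kappa$ continuous and positive on $\partial\Omega$. Let $g\in L^2(\partial\Omega)$. For $u\in L^2(\Omega)$, let $v$ denote the weak solution of $$\partial_t v-\Delta v=0\ \text{ in }\Omega\times(0,\infty),\qquad v(\cdot,0)=u\ \text{ in }\Omega,\qquad \mathcal B(v(\cdot,t))=g\ \text{ on }\partial\Omega,$$ that is, $v\in C([0,\infty);L^2(\Omega))\cap L^2(0,T;H^1(\Omega))$ for all $T>0$, with $v(\cdot,t)|_{\partial\Omega}=g$ for a.e. $t>0$ in the Dirichlet case, and $\frac{d}{dt}\langle v(t),\varphi\rangle+a(v(t),\varphi)=\langle g,\varphi\rangle_{L^2(\partial\Omega)}$ on $(0,\infty)$ (in the sense integrated over $[0,t]$) for all $\varphi\in V$. Here $V$ is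 the space $H^1_0(\Omega)$ of functions with null trace in the Dirichlet case and $H^1(\Omega)$ in the other two, and $a(f,\varphi)=\int_\Omega\nabla f\cdot\nabla\varphi$, with the additional term $\int_{\partial\Omega}\kappa f\varphi\,d\sigma$ in the Robin case. Define $$\mathcal L_g^s[u]:=\frac1{\Gamma(-s)}\int_0^\infty\big(v(\cdot,t)-v(\cdot,0)\big)\frac{dt}{t^{1+s}}$$ as the limit in $L^2(\Omega)$, whenever it exists, of the (absolutely convergent) integrals over $(\varepsilon,\infty)$ as $\varepsilon\to0^+$. Define $(-\Delta_{\mathcal B})^s[u]$ by the same formula with $v$ replaced by $e^{t\Delta_{\mathcal B}}u$, the weak solution of the heat problem with initial value $u$ and boundary datum $g=0$. Let $\mathbb H^{2s}_{\mathcal B}(\Omega)$ be the space of $f\in L^2(\Omega)$ with $\sum_m\lambda_m^{2s}\langle f,\varphi_m\rangle^2<\infty$, where $(\varphi_m)$ is an orthonormal basis of $L^2(\Omega)$ of (weak) eigenfunctions, $-\Delta\varphi_m=\lambda_m\varphi_m$, $\mathcal B(\varphi_m)=0$, with $\lambda_m$ non-decreasing and $\lambda_m\to\infty$. Let $u\in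 H^{2s}(\Omega)$ with $\mathcal B(u)=g$ on $\partial\Omega$, meaning that there are functions $u_k$ smooth up to the boundary with $u_k\to u$ in $H^{2s}(\Omega)$ and $\mathcal B(u_k)\to g$ in $L^2(\partial\Omega)$. Let $z\in H^{2s}(\Omega)$ be a weak solution of $\Delta z=0$ in $\Omega$, $\mathcal B(z)=g$ on $\partial\Omega$: $z\in H^1(\Omega)$, $a(z,\varphi)=\langle g,\varphi\rangle_{L^2(\partial\Omega)}$ for all $\varphi\in V$, and $z|_{\partial\Omega}=g$ in the Dirichlet case. Then: 1. The heat problem with initial value $u$ and boundary datum $g$ has at most one weak solution, and so has the heat problem with initial value $u-z$ and boundary datum $0$. A curve $v$ solves the first if and only if $v-z$ solves the second. 2. $$\mathcal L_g^s[u]=(-\Delta_{\mathcal B})^s[u-z]\qquad\text{in }\Omega,$$ as an identity in $L^2(\Omega)$: one side is defined if and only if the other is, and then they are equal. Both sides are defined whenever $u-z\in\mathbb H^{2s}_{\mathcal B}(\Omega)$. 3. The identity also holds pointwise almost everywhere: if $v$ and $w$ are the solutions of the first and the second problem, represented by jointly measurable functions $v(x,t)$, $w(x,t)$, then for almost every $x\in\Omega$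 and every $\varepsilon\ge0$ the integral $\frac1{\Gamma(-s)}\int_\varepsilon^\infty(v(x,t)-v(x,0))\frac{dt}{t^{1+s}}$ converges absolutely if and only if $\frac1{\Gamma(-s)}\int_\varepsilon^\infty(w(x,t)-w(x,0))\frac{dt}{t^{1+s}}$ does, and then the two are equal. -/

import Mathlib

open MeasureTheory Filter Topology Set
open scoped ContDiff ENNReal

noncomputable section

namespace FracHeat

/-- Euclidean `n`-space. -/
abbrev E (n : ℕ) := EuclideanSpace ℝ (Fin n)

/-! ### Domains, surface measure, outward normal -/

/-- A bounded Lipschitz domain: a nonempty, connected, bounded open set which, near each of its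
boundary points and in a suitable direction `e`, is the strict epigraph of a Lipschitz function of
the component orthogonal to `e`. -/
structure IsLipschitzDomain {n : ℕ} (Ω : Set (E n)) : Prop where
  isOpen : IsOpen Ω
  isBounded : Bornology.IsBounded Ω
  isConnected : IsConnected Ω
  graph : ∀ p ∈ frontier Ω, ∃ (e : E n) (r : ℝ) (K : NNReal) (γ : E n → ℝ),
    ‖e‖ = 1 ∧ 0 < r ∧ LipschitzWith K γ ∧
      ∀ x ∈ Metric.ball p r, x ∈ Ω ↔ γ (x - inner ℝ e x • e) < inner ℝ e x

/-- The surface measure of `∂Ω`: the Euclidean (normalised) `(n-1)`-dimensional Hausdorff measure,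
restricted to the boundary. As a measure on the whole space it is carried by `∂Ω`. -/
def surf {n : ℕ} (Ω : Set (E n)) : Measure (E n) :=
  (Measure.euclideanHausdorffMeasure (n - 1)).restrict (frontier Ω)

/-- `ν` is the unit outward normal of `Ω` at `p`: up to first order, `Ω` is near `p` the half-space
`⟪y - p, ν⟫ < 0`. On a Lipschitz domain there is exactly one such `ν` at almost every boundary
point. -/
def IsOutwardNormal {n : ℕ} (Ω : Set (E n)) (p ν : E n) : Prop :=
  ‖ν‖ = 1 ∧ ∀ ε > (0 : ℝ), ∀ᶠ y in 𝓝 p,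
    (inner ℝ (y - p) ν < -ε * ‖y - p‖ → y ∈ Ω) ∧ (ε * ‖y - p‖ < inner ℝ (y - p) ν → y ∉ Ω)

open Classical in
/-- The unit outward normal field (zero at the negligible set of points without a normal). -/
def outwardNormal {n : ℕ} (Ω : Set (E n)) (p : E n) : E n :=
  if h : ∃ ν, IsOutwardNormal Ω p ν then h.choose else 0

/-! ### Boundary operators -/

/-- The Dirichlet, Neumann and Robin boundary operators. -/
inductive BoundaryOp (n : ℕ) : Type
  | dirichlet : BoundaryOp n
  | neumann : BoundaryOp n
  | robin (κ : E n → ℝ) : BoundaryOp n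

/-- In the Robin case the coefficient `κ` is continuous and positive on `∂Ω`. -/
def BoundaryOp.Regular {n : ℕ} (Ω : Set (E n)) : BoundaryOp n → Prop
  | .dirichlet => True
  | .neumann => True
  | .robin κ => ContinuousOn κ (frontier Ω) ∧ ∀ x ∈ frontier Ω, 0 < κ x

/-- The value at `x ∈ ∂Ω` of the boundary operator on a smooth function:
`φ`, `∂φ/∂ν`, or `κ φ + ∂φ/∂ν`. -/
def BoundaryOp.apply {n : ℕ} (Ω : Set (E n)) : BoundaryOp n → (E n → ℝ) → E n → ℝ
  | .dirichlet, φ, x => φ x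
  | .neumann, φ, x => fderiv ℝ φ x (outwardNormal Ω x)
  | .robin κ, φ, x => κ x * φ x + fderiv ℝ φ x (outwardNormal Ω x)

/-! ### Sobolev spaces -/

/-- `G` is the weak (distributional) gradient of `f` in `Ω`. -/
def HasWeakGradient {n : ℕ} (Ω : Set (E n)) (f : E n → ℝ) (G : E n → E n) : Prop :=
  LocallyIntegrableOn f Ω ∧ LocallyIntegrableOn G Ω ∧
    ∀ φ : E n → ℝ, ContDiff ℝ ∞ φ → HasCompactSupport φ → tsupport φ ⊆ Ω →
      ∀ e : E n, ∫ x in Ω, f x * fderiv ℝ φ x e = -∫ x in Ω, inner ℝ (G x) e * φ x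

/-- The Gagliardo seminorm of order `σ ∈ (0,1)` on `Ω`. -/
def gagliardo {n : ℕ} (Ω : Set (E n)) (σ : ℝ) (f : E n → ℝ) : ℝ≥0∞ :=
  (∫⁻ x in Ω, ∫⁻ y in Ω, ‖f x - f y‖ₑ ^ (2 : ℝ) / ‖x - y‖ₑ ^ ((n : ℝ) + 2 * σ)) ^ (1 / 2 : ℝ)

/-- The norm of `W^{m+σ,2}(Ω)`, for `m ∈ ℕ` and `0 ≤ σ < 1`; it is `∞` on functions outside the
space. The infimum is over the weak gradients of `f`, which are all equal almost everywhere, and is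
`∞` if there is none. -/
def hsNorm {n : ℕ} (Ω : Set (E n)) (σ : ℝ) : ℕ → (E n → ℝ) → ℝ≥0∞
  | 0, f => eLpNorm f 2 (volume.restrict Ω) + (if σ = 0 then 0 else gagliardo Ω σ f)
  | m + 1, f => eLpNorm f 2 (volume.restrict Ω) +
      ⨅ (G : E n → E n) (_ : HasWeakGradient Ω f G), ∑ i : Fin n, hsNorm Ω σ m (fun x => G x i)

/-- The Sobolev norm of order `r ≥ 0`. -/
def sobolevNorm {n : ℕ} (Ω : Set (E n)) (r : ℝ) (f : E n → ℝ) : ℝ≥0∞ :=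
  hsNorm Ω (Int.fract r) ⌊r⌋₊ f

/-- `f ∈ H^r(Ω) = W^{r,2}(Ω)`. -/
def MemSobolev {n : ℕ} (Ω : Set (E n)) (r : ℝ) (f : E n → ℝ) : Prop :=
  AEStronglyMeasurable f (volume.restrict Ω) ∧ sobolevNorm Ω r f < ⊤

/-- `L²(Ω)`. -/
abbrev L2 {n : ℕ} (Ω : Set (E n)) := Lp ℝ 2 (volume.restrict Ω)

/-- `L²(Ω; ℝⁿ)`. -/
abbrev L2v {n : ℕ} (Ω : Set (E n)) := Lp (E n) 2 (volume.restrict Ω)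

/-- `L²(∂Ω)`. -/
abbrev L2b {n : ℕ} (Ω : Set (E n)) := Lp ℝ 2 (surf Ω)

/-- `B(f) = g` on `∂Ω` for `f ∈ H^r(Ω)`, where `B` is extended by continuity from smooth functions:
`f` is the limit in `H^r(Ω)` of functions `φ k` smooth up to the boundary such that `B(φ k) → g` in
`L²(∂Ω)`. -/
def HasBoundaryValue {n : ℕ} (Ω : Set (E n)) (B : BoundaryOp n) (r : ℝ) (f : E n → ℝ)
    (g : L2b Ω) : Prop :=
  ∃ φ : ℕ → E n → ℝ, (∀ k, ContDiff ℝ ∞ (φ k)) ∧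
    Tendsto (fun k => sobolevNorm Ω r (fun x => φ k x - f x)) atTop (𝓝 0) ∧
    Tendsto (fun k => eLpNorm (fun x => B.apply Ω (φ k) x - g x) 2 (surf Ω)) atTop (𝓝 0)

/-- `f ∈ H¹(Ω)` with gradient `G`. (Functions smooth up to the boundary are dense in the `H¹` space
of a Lipschitz domain, so the second clause holds for every `f ∈ H¹(Ω)`.) -/
def IsH1 {n : ℕ} (Ω : Set (E n)) (f : L2 Ω) (G : L2v Ω) : Prop :=
  HasWeakGradient Ω f G ∧ ∃ φ : ℕ → E n → ℝ, (∀ k, ContDiff ℝ ∞ (φ k)) ∧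
    Tendsto (fun k => eLpNorm (fun x => φ k x - f x) 2 (volume.restrict Ω)) atTop (𝓝 0) ∧
    Tendsto (fun k => eLpNorm (fun x => gradient (φ k) x - G x) 2 (volume.restrict Ω)) atTop (𝓝 0)

/-- `f ∈ H¹(Ω)` with gradient `G` and trace `h` on `∂Ω`: along some sequence of functions smooth up
to the boundary that converges to `f` in `H¹(Ω)`, the boundary values converge to `h` in
`L²(∂Ω)`. -/
def HasTrace {n : ℕ} (Ω : Set (E n)) (f : L2 Ω) (G : L2v Ω) (h : L2b Ω) : Prop :=
  HasWeakGradient Ω f G ∧ ∃ φ : ℕ → E n → ℝ, (∀ k, ContDiff ℝ ∞ (φ k)) ∧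
    Tendsto (fun k => eLpNorm (fun x => φ k x - f x) 2 (volume.restrict Ω)) atTop (𝓝 0) ∧
    Tendsto (fun k => eLpNorm (fun x => gradient (φ k) x - G x) 2 (volume.restrict Ω)) atTop (𝓝 0) ∧
    Tendsto (fun k => eLpNorm (fun x => φ k x - h x) 2 (surf Ω)) atTop (𝓝 0)

/-! ### Weak formulations -/

/-- The bilinear form of `-Δ` with boundary operator `B`: `∫_Ω ∇f · ∇φ` in the Dirichlet and Neumann
cases, `∫_Ω ∇f · ∇φ + ∫_{∂Ω} κ f φ` in the Robin case. It takes the gradients `G`, `Gφ` and the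
traces `h`, `η` of `f`, `φ`. -/
def energy {n : ℕ} (Ω : Set (E n)) : BoundaryOp n → L2v Ω → L2b Ω → L2v Ω → L2b Ω → ℝ
  | .dirichlet, G, _, Gφ, _ => inner ℝ G Gφ
  | .neumann, G, _, Gφ, _ => inner ℝ G Gφ
  | .robin κ, G, h, Gφ, η => inner ℝ G Gφ + ∫ x, κ x * (h x * η x) ∂(surf Ω)

/-- The test functions `φ` (with gradient `Gφ` and trace `η`): all of `H¹(Ω)` in the Neumann and
Robin cases, the functions of null trace in the Dirichlet case. -/
def IsTest {n : ℕ} (Ω : Set (E n)) (B : BoundaryOp n) (φ : L2 Ω) (Gφ : L2v Ω) (η : L2b Ω) : Prop :=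
  HasTrace Ω φ Gφ η ∧ (B = .dirichlet → η = 0)

/-- The class in which solutions with boundary datum `g` are sought: `f ∈ H¹(Ω)` has gradient `G`
and trace `h`; in the Dirichlet case the trace is the prescribed `g`. In the Neumann case the trace
is not part of the formulation, and `h` plays no role. -/
def Admissible {n : ℕ} (Ω : Set (E n)) :
    BoundaryOp n → L2b Ω → L2 Ω → L2v Ω → L2b Ω → Prop
  | .dirichlet, g, f, G, h => HasTrace Ω f G h ∧ h = g
  | .neumann, _, f, G, _ => IsH1 Ω f G
  | .robin _, _, f, G, h => HasTrace Ω f G h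

/-- `z` is a (weak, `H¹`) solution of `Δz = 0` in `Ω`, `B(z) = g` on `∂Ω`. (In the Dirichlet case
`η = 0`, so the right-hand side vanishes.) -/
def IsHarmonicExtension {n : ℕ} (Ω : Set (E n)) (B : BoundaryOp n) (g : L2b Ω) (z : L2 Ω) : Prop :=
  ∃ (G : L2v Ω) (h : L2b Ω), Admissible Ω B g z G h ∧
    ∀ φ Gφ η, IsTest Ω B φ Gφ η → energy Ω B G h Gφ η = inner ℝ g η

/-- `v` is a weak solution of the heat equation `∂ₜv - Δv = 0` in `Ω × (0,∞)` with `v(0) = u` and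
`B(v(t)) = g` on `∂Ω`: `v ∈ C([0,∞); L²(Ω)) ∩ L²(0,T; H¹(Ω))` for every `T`, and
`d/dt ⟨v(t), φ⟩ + a(v(t), φ) = ⟨g, φ⟩_{∂Ω}` for all test functions `φ`, written in its form
integrated in time. Values of `v` at negative times are irrelevant. -/
def IsHeatSolution {n : ℕ} (Ω : Set (E n)) (B : BoundaryOp n) (g : L2b Ω) (u : L2 Ω)
    (v : ℝ → L2 Ω) : Prop :=
  v 0 = u ∧ ContinuousOn v (Ici 0) ∧
  ∃ (G : ℝ → L2v Ω) (h : ℝ → L2b Ω),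
    (∀ T > (0 : ℝ), MemLp G 2 (volume.restrict (Ioc 0 T)) ∧
      MemLp h 2 (volume.restrict (Ioc 0 T))) ∧
    (∀ᵐ t ∂(volume.restrict (Ioi (0 : ℝ))), Admissible Ω B g (v t) (G t) (h t)) ∧
    ∀ φ Gφ η, IsTest Ω B φ Gφ η → ∀ t ≥ (0 : ℝ),
      inner ℝ (v t) φ - inner ℝ u φ + ∫ τ in (0 : ℝ)..t, energy Ω B (G τ) (h τ) Gφ η
        = t * inner ℝ g η

/-! ### The nonlocal operators -/

/-- `(1/Γ(-s)) ∫_0^∞ (v(t) - v(0)) dt/t^{1+s} = f` in `L²(Ω)`; the integral converges absolutely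
away from `t = 0` and is improper at `t = 0`. -/
def HasFracIntegral {n : ℕ} {Ω : Set (E n)} (s : ℝ) (v : ℝ → L2 Ω) (f : L2 Ω) : Prop :=
  (∀ ε > (0 : ℝ), IntegrableOn (fun t : ℝ => (t ^ (1 + s))⁻¹ • (v t - v 0)) (Ioi ε)) ∧
  Tendsto (fun ε : ℝ => (Real.Gamma (-s))⁻¹ • ∫ t in Ioi ε, (t ^ (1 + s))⁻¹ • (v t - v 0))
    (𝓝[>] 0) (𝓝 f)

/-- `L_g^s[u]` is defined and equal to `f`. -/
def IsNonhomFrac {n : ℕ} (Ω : Set (E n)) (B : BoundaryOp n) (g : L2b Ω) (s : ℝ) (u f : L2 Ω) :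
    Prop :=
  ∃ v, IsHeatSolution Ω B g u v ∧ HasFracIntegral s v f

/-- `(-Δ_B)^s u` is defined and equal to `f`; here `e^{tΔ_B} u` is the solution of the heat equation
with homogeneous boundary condition. -/
def IsFracLaplacian {n : ℕ} (Ω : Set (E n)) (B : BoundaryOp n) (s : ℝ) (u f : L2 Ω) : Prop :=
  ∃ w, IsHeatSolution Ω B 0 u w ∧ HasFracIntegral s w f

/-- The pointwise integral `(1/Γ(-s)) ∫_ε^∞ (V(x,t) - V(x,0)) dt/t^{1+s}`. -/
def fracIntegralAt {n : ℕ} (s : ℝ) (V : ℝ → E n → ℝ) (ε : ℝ) (x : E n) : ℝ :=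
  (Real.Gamma (-s))⁻¹ * ∫ t in Ioi ε, (V t x - V 0 x) / t ^ (1 + s)

/-- `V` is a jointly measurable function of `(t, x)` representing the curve `v` in `L²(Ω)`. -/
def Represents {n : ℕ} {Ω : Set (E n)} (V : ℝ → E n → ℝ) (v : ℝ → L2 Ω) : Prop :=
  AEStronglyMeasurable (Function.uncurry V)
    ((volume.restrict (Ioi (0 : ℝ))).prod (volume.restrict Ω)) ∧
  ∀ t ≥ (0 : ℝ), V t =ᵐ[volume.restrict Ω] v t

/-! ### The spectral space -/

/-- `φ` satisfies `-Δφ = μ φ` in `Ω`, `B(φ) = 0` on `∂Ω` (weakly). -/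
def IsEigenfunction {n : ℕ} (Ω : Set (E n)) (B : BoundaryOp n) (μ : ℝ) (φ : L2 Ω) : Prop :=
  ∃ (G : L2v Ω) (h : L2b Ω), Admissible Ω B 0 φ G h ∧
    ∀ ψ Gψ η, IsTest Ω B ψ Gψ η → energy Ω B G h Gψ η = μ * inner ℝ φ ψ

/-- `f ∈ ℍ_B^r(Ω)`: `∑ λ_m^r |⟨f, φ_m⟩|² < ∞` for an orthonormal basis of eigenfunctions `φ_m` with
eigenvalues `λ_m`. The condition does not depend on the basis. -/
def MemSpectral {n : ℕ} (Ω : Set (E n)) (B : BoundaryOp n) (r : ℝ) (f : L2 Ω) : Prop :=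
  ∃ (φ : HilbertBasis ℕ ℝ (L2 Ω)) (lam : ℕ → ℝ),
    (∀ m, IsEigenfunction Ω B (lam m) (φ m)) ∧ Monotone lam ∧ Tendsto lam atTop atTop ∧
    Summable (fun m => lam m ^ r * inner ℝ f (φ m) ^ 2)

end FracHeat

end

open FracHeat

noncomputable section

namespace FracHeat

/-! ### Finiteness of the surface measure -/

/-! The function `z` does not depend on time, so `v ↦ v - z` carries the problem with datum `g` to
the problem with datum `0` and leaves every increment `v t - v 0` unchanged. The two fractional
integrals therefore have the same integrand (`IsHeatSolution.add_harmonic`,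
`hasFracIntegral_sub_const`). For this shift the classes of admissible functions must be linear.
They are identified with closures of spaces of smooth functions in products of `L²` spaces
(`isH1_iff`, `hasTrace_iff`); smooth functions have boundary values in `L²(∂Ω)` because the surface
measure is finite.

What remains concerns the homogeneous problem, written abstractly with a form domain `D ⊆ H × K` of
pairs (function, energy part) and a form `a` on `K`. Uniqueness (`IsEvolution.eqOn_zero`) comes from
testing at time `t` with `w t` itself and integrating in `t`; symmetry turns the double integral
over a triangle into half of `a(Y, Y) ≥ 0`, where `Y` is the time integral of the energy part, and
no time derivative is needed. Existence, given an eigenbasis, comes from the series `∑ exp(-λ t) ⟨u,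
φ⟩ φ` (`isEvolution_semigroup`). Its fractional integral converges by dominated convergence of
coefficients, since `∫ (1 - exp(-λ t)) t^(-1-s) dt` is `λ^s` times a constant
(`tendsto_frac_semigroup`).

The pointwise identity follows from the one in `L²` by Fubini (`Represents.ae_ae_sub_eq`). -/

lemma hausdorffMeasure_graph_lt_top {n : ℕ} (e : E n) (he : ‖e‖ = 1) {K : NNReal} {γ : E n → ℝ}
    (hγ : LipschitzWith K γ) (R : ℝ) :
    (μH[((n - 1 : ℕ) : ℝ)] : Measure (E n))
      ((fun y : (ℝ ∙ e)ᗮ => (y : E n) + γ y • e) '' Metric.ball 0 R) < ⊤ := by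
  have hfin : Module.finrank ℝ (ℝ ∙ e)ᗮ = n - 1 := by
    have h1 := Submodule.finrank_add_finrank_orthogonal (ℝ ∙ e)
    have h2 : Module.finrank ℝ (ℝ ∙ e) = 1 := finrank_span_singleton (by
      rintro rfl; simp at he)
    rw [finrank_euclideanSpace_fin] at h1
    omega
  -- The graph is a Lipschitz image of a ball in the hyperplane orthogonal to `e`. There the
  -- Hausdorff measure of dimension `n - 1` is a Haar measure, hence finite on balls.
  have hL : LipschitzWith (1 + K) (fun y : (ℝ ∙ e)ᗮ => (y : E n) + γ y • e) := by
    refine (LipschitzWith.subtype_val _).add ?_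
    refine LipschitzWith.of_dist_le_mul fun x y => ?_
    rw [dist_eq_norm, ← sub_smul, norm_smul, he, mul_one, ← dist_eq_norm]
    exact hγ.dist_le_mul _ _
  refine (hL.hausdorffMeasure_image_le (Nat.cast_nonneg _) _).trans_lt ?_
  refine ENNReal.mul_lt_top (ENNReal.rpow_lt_top_of_nonneg (Nat.cast_nonneg _) (by simp)) ?_
  rw [← hfin]
  have := isAddHaarMeasure_hausdorffMeasure (E := (ℝ ∙ e)ᗮ)
  exact measure_ball_lt_top

/-- The compact boundary is covered by finitely many patches, each contained in a Lipschitz graph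
over a bounded piece of a hyperplane. -/
lemma IsLipschitzDomain.isFiniteMeasure_surf {n : ℕ} {Ω : Set (E n)} (hΩ : IsLipschitzDomain Ω) :
    IsFiniteMeasure (surf Ω) := by
  have hc : IsCompact (frontier Ω) :=
    Metric.isCompact_of_isClosed_isBounded isClosed_frontier
      (hΩ.isBounded.closure.subset frontier_subset_closure)
  have key : (μH[((n - 1 : ℕ) : ℝ)] : Measure (E n)) (frontier Ω) < ⊤ := by
    refine hc.measure_lt_top_of_nhdsWithin fun p hp => ?_
    obtain ⟨e, r, K, γ, he, hr, hγ, hg⟩ := hΩ.graph p hp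
    refine ⟨frontier Ω ∩ Metric.ball p r,
      inter_mem_nhdsWithin _ (Metric.ball_mem_nhds p hr), ?_⟩
    -- The projection of `x` orthogonal to `e` has norm at most `2‖x‖ < 2(‖p‖ + r)`, which dictates
    -- the radius.
    refine (measure_mono ?_).trans_lt
      (hausdorffMeasure_graph_lt_top e he hγ (2 * (‖p‖ + r) + 1))
    rintro x ⟨hx, hxr⟩
    have hcγ : Continuous fun x : E n => γ (x - inner ℝ e x • e) :=
      hγ.continuous.comp (by fun_prop)
    have hci : Continuous fun x : E n => inner ℝ e x := by fun_prop
    have hball : Metric.ball p r ∈ 𝓝 x := Metric.isOpen_ball.mem_nhds hxr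
    -- A boundary point lies on the graph: strictly above it would belong to the open set `Ω`, and
    -- strictly below it would have a neighbourhood disjoint from `Ω`.
    have heq : γ (x - inner ℝ e x • e) = inner ℝ e x := by
      rcases lt_trichotomy (γ (x - inner ℝ e x • e)) (inner ℝ e x) with h | h | h
      · exact absurd ((hg x hxr).2 h) (by
          rw [hΩ.isOpen.frontier_eq] at hx; exact hx.2)
      · exact h
      · exfalso
        have h1 : ∀ᶠ y in 𝓝 x, y ∉ Ω := by
          filter_upwards [hball, hci.continuousAt.eventually_lt hcγ.continuousAt h] with y hy hy'
          rw [hg y hy]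
          exact not_lt.2 hy'.le
        obtain ⟨y, hy1, hy2⟩ :=
          ((mem_closure_iff_frequently.1 (frontier_subset_closure hx)).and_eventually h1).exists
        exact hy2 hy1
    have hin : inner ℝ e (x - inner ℝ e x • e) = (0 : ℝ) := by
      rw [inner_sub_right, inner_smul_right, real_inner_self_eq_norm_sq, he]; ring
    have hmem : x - inner ℝ e x • e ∈ (ℝ ∙ e)ᗮ := by
      rw [Submodule.mem_orthogonal_singleton_iff_inner_right]; exact hin
    refine ⟨⟨_, hmem⟩, ?_, ?_⟩
    · have hx1 : ‖x‖ < ‖p‖ + r := by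
        have h2 := norm_le_norm_add_norm_sub' x p
        have h3 : ‖x - p‖ < r := by simpa [dist_eq_norm] using hxr
        linarith
      have h2 : |inner ℝ e x| ≤ ‖x‖ := by
        simpa [he] using abs_real_inner_le_norm e x
      have h3 : ‖x - inner ℝ e x • e‖ ≤ ‖x‖ + ‖x‖ := by
        refine (norm_sub_le _ _).trans ?_
        rw [norm_smul, he, mul_one, Real.norm_eq_abs]
        linarith
      simp only [Metric.mem_ball, dist_zero_right, Submodule.coe_norm]
      linarith
    · simp only
      rw [heq]
      abel
  refine ⟨?_⟩
  rw [surf, Measure.restrict_apply_univ, Measure.euclideanHausdorffMeasure_def,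
    Measure.smul_apply]
  exact ENNReal.mul_lt_top ENNReal.coe_lt_top key

/-! ### Function spaces as closures of the smooth functions -/

lemma memLp_of_continuous {n : ℕ} {F : Type*} [NormedAddCommGroup F] {μ : Measure (E n)}
    [IsFiniteMeasure μ] {K : Set (E n)} (hK : IsCompact K) (hμ : ∀ᵐ x ∂μ, x ∈ K)
    {f : E n → F} (hf : Continuous f) (p : ℝ≥0∞) : MemLp f p μ := by
  obtain ⟨C, hC⟩ := hK.exists_bound_of_continuousOn hf.continuousOn
  exact MemLp.of_bound hf.aestronglyMeasurable C (hμ.mono hC)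

variable {n : ℕ} {Ω : Set (E n)}

lemma IsLipschitzDomain.isFiniteMeasure_restrict (hΩ : IsLipschitzDomain Ω) :
    IsFiniteMeasure (volume.restrict Ω) :=
  ⟨by rw [Measure.restrict_apply_univ]; exact hΩ.isBounded.measure_lt_top⟩

lemma IsLipschitzDomain.isCompact_frontier (hΩ : IsLipschitzDomain Ω) : IsCompact (frontier Ω) :=
  Metric.isCompact_of_isClosed_isBounded isClosed_frontier
    (hΩ.isBounded.closure.subset frontier_subset_closure)

lemma ae_surf_mem_frontier (Ω : Set (E n)) : ∀ᵐ x ∂(surf Ω), x ∈ frontier Ω :=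
  ae_restrict_mem isClosed_frontier.measurableSet

lemma IsLipschitzDomain.memLp_restrict (hΩ : IsLipschitzDomain Ω) {F : Type*}
    [NormedAddCommGroup F] {f : E n → F} (hf : Continuous f) :
    MemLp f 2 (volume.restrict Ω) := by
  have := hΩ.isFiniteMeasure_restrict
  refine memLp_of_continuous (K := closure Ω)
    (Metric.isCompact_of_isClosed_isBounded isClosed_closure hΩ.isBounded.closure) ?_ hf 2
  exact (ae_restrict_mem hΩ.isOpen.measurableSet).mono fun x hx => subset_closure hx

lemma IsLipschitzDomain.memLp_surf (hΩ : IsLipschitzDomain Ω) {f : E n → ℝ} (hf : Continuous f) :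
    MemLp f 2 (surf Ω) := by
  have := hΩ.isFiniteMeasure_surf
  exact memLp_of_continuous hΩ.isCompact_frontier (ae_surf_mem_frontier Ω) hf 2

/-- The smooth functions on `ℝⁿ`. -/
def smoothFunctions (n : ℕ) : Submodule ℝ (E n → ℝ) where
  carrier := {φ | ContDiff ℝ ∞ φ}
  add_mem' h h' := by
    rw [mem_ofPred_eq] at *
    exact ContDiff.add h h'
  zero_mem' := by
    rw [mem_ofPred_eq]
    exact contDiff_const
  smul_mem' c _ h := by
    rw [mem_ofPred_eq] at *
    exact contDiff_const.smul h

lemma mem_smoothFunctions {φ : E n → ℝ} : φ ∈ smoothFunctions n ↔ ContDiff ℝ ∞ φ := by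
  rw [smoothFunctions, ← SetLike.mem_coe]
  exact mem_ofPred_eq ▸ Iff.rfl

lemma contDiff_smoothFunctions (φ : smoothFunctions n) : ContDiff ℝ ∞ φ.1 :=
  mem_smoothFunctions.1 φ.2

lemma continuous_gradient {φ : E n → ℝ} (hφ : ContDiff ℝ ∞ φ) : Continuous (gradient φ) :=
  (InnerProductSpace.toDual ℝ (E n)).symm.continuous.comp (hφ.continuous_fderiv (by simp))

lemma inner_gradient (φ : E n → ℝ) (x e : E n) :
    inner ℝ (gradient φ x) e = fderiv ℝ φ x e := by
  simp [gradient]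

/-- A smooth function, its gradient and its boundary values. -/
def IsLipschitzDomain.smoothTriple (hΩ : IsLipschitzDomain Ω) :
    smoothFunctions n →ₗ[ℝ] L2 Ω × L2v Ω × L2b Ω where
  toFun φ := ((hΩ.memLp_restrict (contDiff_smoothFunctions φ).continuous).toLp φ.1,
    (hΩ.memLp_restrict (continuous_gradient (contDiff_smoothFunctions φ))).toLp (gradient φ.1),
    (hΩ.memLp_surf (contDiff_smoothFunctions φ).continuous).toLp φ.1)
  map_add' φ ψ := by
    have h : gradient (φ.1 + ψ.1) = gradient φ.1 + gradient ψ.1 := by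
      ext1 x
      simp [gradient, fderiv_add ((contDiff_smoothFunctions φ).differentiable (by simp)).differentiableAt
        ((contDiff_smoothFunctions ψ).differentiable (by simp)).differentiableAt]
    refine Prod.ext rfl (Prod.ext ?_ rfl)
    refine Eq.trans ?_ (MemLp.toLp_add (hΩ.memLp_restrict (continuous_gradient (contDiff_smoothFunctions φ)))
      (hΩ.memLp_restrict (continuous_gradient (contDiff_smoothFunctions ψ))))
    exact MemLp.toLp_congr (hΩ.memLp_restrict (continuous_gradient (contDiff_smoothFunctions _))) _
      (by rw [← h]; rfl)
  map_smul' c φ := by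
    have h : gradient (c • φ.1) = c • gradient φ.1 := by
      ext1 x
      simp [gradient, fderiv_const_smul ((contDiff_smoothFunctions φ).differentiable (by simp)).differentiableAt]
    refine Prod.ext rfl (Prod.ext ?_ rfl)
    refine Eq.trans ?_ (MemLp.toLp_const_smul c (hΩ.memLp_restrict (continuous_gradient (contDiff_smoothFunctions φ))))
    exact MemLp.toLp_congr (hΩ.memLp_restrict (continuous_gradient (contDiff_smoothFunctions _))) _
      (by rw [← h]; rfl)

/-- The closed space of the triples `(f, ∇f, f|_{∂Ω})`. -/
def IsLipschitzDomain.traceSpace (hΩ : IsLipschitzDomain Ω) :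
    Submodule ℝ (L2 Ω × L2v Ω × L2b Ω) :=
  (LinearMap.range hΩ.smoothTriple).topologicalClosure

/-- A smooth function and its gradient. -/
def IsLipschitzDomain.smoothPair (hΩ : IsLipschitzDomain Ω) :
    smoothFunctions n →ₗ[ℝ] L2 Ω × L2v Ω :=
  ((LinearMap.fst ℝ (L2 Ω) (L2v Ω × L2b Ω)).prod
    ((LinearMap.fst ℝ (L2v Ω) (L2b Ω)).comp (LinearMap.snd ℝ (L2 Ω) (L2v Ω × L2b Ω)))).comp
    hΩ.smoothTriple

/-- The closed space of the pairs `(f, ∇f)`. -/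
def IsLipschitzDomain.sobolevSpace (hΩ : IsLipschitzDomain Ω) : Submodule ℝ (L2 Ω × L2v Ω) :=
  (LinearMap.range hΩ.smoothPair).topologicalClosure

lemma integral_mul_eq_inner {α : Type*} {m : MeasurableSpace α} {μ : Measure α} (f : Lp ℝ 2 μ)
    {ψ : α → ℝ} (hψ : MemLp ψ 2 μ) : ∫ x, f x * ψ x ∂μ = inner ℝ (hψ.toLp ψ) f := by
  rw [L2.inner_def]
  refine integral_congr_ae ?_
  filter_upwards [hψ.coeFn_toLp] with x hx
  simp [hx]

lemma integral_inner_mul_eq_inner {α : Type*} {m : MeasurableSpace α} {μ : Measure α}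
    (G : Lp (E n) 2 μ) (e : E n) {ψ : α → ℝ} (hψ : MemLp (fun x => ψ x • e) 2 μ) :
    ∫ x, inner ℝ (G x) e * ψ x ∂μ = inner ℝ (hψ.toLp _) G := by
  rw [L2.inner_def]
  refine integral_congr_ae ?_
  filter_upwards [hψ.coeFn_toLp] with x hx
  rw [hx, inner_smul_left, real_inner_comm]
  simp [mul_comm]

lemma IsLipschitzDomain.locallyIntegrableOn (hΩ : IsLipschitzDomain Ω) {F : Type*}
    [NormedAddCommGroup F] {f : E n → F} (hf : MemLp f 2 (volume.restrict Ω)) :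
    LocallyIntegrableOn f Ω := by
  have := hΩ.isFiniteMeasure_restrict
  exact IntegrableOn.locallyIntegrableOn (hf.integrable (by norm_num))

/-- For a fixed test function and direction, both sides are `L²` pairings, continuous in the pair.
Local integrability is automatic, as `L²` embeds in `L¹` on a bounded domain. -/
lemma IsLipschitzDomain.isClosed_hasWeakGradient (hΩ : IsLipschitzDomain Ω) :
    IsClosed {p : L2 Ω × L2v Ω | HasWeakGradient Ω p.1 p.2} := by
  have h : {p : L2 Ω × L2v Ω | HasWeakGradient Ω p.1 p.2} =
      ⋂ (φ : E n → ℝ) (_ : ContDiff ℝ ∞ φ) (_ : HasCompactSupport φ) (_ : tsupport φ ⊆ Ω)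
        (e : E n), {p : L2 Ω × L2v Ω | ∫ x in Ω, p.1 x * fderiv ℝ φ x e =
          -∫ x in Ω, inner ℝ (p.2 x) e * φ x} := by
    ext p
    simp only [mem_ofPred_eq, mem_iInter, HasWeakGradient]
    exact ⟨fun h => h.2.2, fun h => ⟨hΩ.locallyIntegrableOn (Lp.memLp _),
      hΩ.locallyIntegrableOn (Lp.memLp _), h⟩⟩
  rw [h]
  refine isClosed_iInter fun φ => isClosed_iInter fun hφ => isClosed_iInter fun _ =>
    isClosed_iInter fun _ => isClosed_iInter fun e => ?_
  have h1 : Continuous fun x => fderiv ℝ φ x e :=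
    (hφ.continuous_fderiv (by simp)).clm_apply continuous_const
  have h2 : Continuous fun x => φ x • e := hφ.continuous.smul continuous_const
  simp_rw [fun f : L2 Ω => integral_mul_eq_inner f (hΩ.memLp_restrict h1),
    fun G : L2v Ω => integral_inner_mul_eq_inner G e (hΩ.memLp_restrict h2)]
  exact isClosed_eq (by fun_prop) (by fun_prop)

/-- The test function is supported in `Ω`, so both integrals extend to the whole space, where
integration by parts has no boundary term. -/
lemma IsLipschitzDomain.hasWeakGradient_smoothPair (hΩ : IsLipschitzDomain Ω)
    (φ : smoothFunctions n) :
    HasWeakGradient Ω (hΩ.smoothPair φ).1 (hΩ.smoothPair φ).2 := by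
  refine ⟨hΩ.locallyIntegrableOn (Lp.memLp _), hΩ.locallyIntegrableOn (Lp.memLp _), ?_⟩
  intro ψ hψ hψc hψΩ e
  have hc1 : Continuous fun x => fderiv ℝ ψ x e :=
    (hψ.continuous_fderiv (by simp)).clm_apply continuous_const
  have hc2 : Continuous fun x => fderiv ℝ φ.1 x e :=
    ((contDiff_smoothFunctions φ).continuous_fderiv (by simp)).clm_apply continuous_const
  have hs : HasCompactSupport fun x => fderiv ℝ ψ x e := hψc.fderiv_apply (𝕜 := ℝ) e
  have e1 : ∫ x in Ω, (hΩ.smoothPair φ).1 x * fderiv ℝ ψ x e = ∫ x, φ.1 x * fderiv ℝ ψ x e := by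
    refine Eq.trans ?_ (setIntegral_eq_integral_of_forall_compl_eq_zero (s := Ω) ?_)
    · refine integral_congr_ae ?_
      filter_upwards [(hΩ.memLp_restrict (contDiff_smoothFunctions φ).continuous).coeFn_toLp] with x hx
      rw [← hx]
      rfl
    · intro x hx
      have : fderiv ℝ ψ x = 0 := by
        by_contra h
        exact hx (hψΩ (support_fderiv_subset ℝ (Function.mem_support.2 h)))
      simp [this]
  have e2 : ∫ x in Ω, inner ℝ ((hΩ.smoothPair φ).2 x) e * ψ x = ∫ x, fderiv ℝ φ.1 x e * ψ x := by
    refine Eq.trans ?_ (setIntegral_eq_integral_of_forall_compl_eq_zero (s := Ω) ?_)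
    · refine integral_congr_ae ?_
      filter_upwards [(hΩ.memLp_restrict (continuous_gradient (contDiff_smoothFunctions φ))).coeFn_toLp] with x hx
      rw [← inner_gradient, ← hx]
      rfl
    · intro x hx
      rw [image_eq_zero_of_notMem_tsupport fun h => hx (hψΩ h), mul_zero]
  rw [e1, e2]
  refine integral_mul_fderiv_eq_neg_fderiv_mul_of_integrable ?_ ?_ ?_
    (fun x _ => ((contDiff_smoothFunctions φ).differentiable (by simp)).differentiableAt)
    (fun x _ => (hψ.differentiable (by simp)).differentiableAt)
  · exact (hc2.mul hψ.continuous).integrable_of_hasCompactSupport hψc.mul_left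
  · exact ((contDiff_smoothFunctions φ).continuous.mul hc1).integrable_of_hasCompactSupport hs.mul_left
  · exact ((contDiff_smoothFunctions φ).continuous.mul hψ.continuous).integrable_of_hasCompactSupport hψc.mul_left

lemma IsLipschitzDomain.hasWeakGradient_of_mem_sobolevSpace (hΩ : IsLipschitzDomain Ω) {f : L2 Ω}
    {G : L2v Ω} (h : (f, G) ∈ hΩ.sobolevSpace) : HasWeakGradient Ω f G := by
  have h1 : ((LinearMap.range hΩ.smoothPair : Submodule ℝ (L2 Ω × L2v Ω)) : Set (L2 Ω × L2v Ω)) ⊆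
      {p : L2 Ω × L2v Ω | HasWeakGradient Ω p.1 p.2} := by
    rintro _ ⟨φ, rfl⟩
    exact hΩ.hasWeakGradient_smoothPair φ
  exact closure_minimal h1 hΩ.isClosed_hasWeakGradient h

lemma tendsto_toLp_iff {α F : Type*} {m : MeasurableSpace α} {μ : Measure α}
    [NormedAddCommGroup F] {f : ℕ → α → F} (hf : ∀ k, MemLp (f k) 2 μ) (g : Lp F 2 μ) :
    Tendsto (fun k => (hf k).toLp (f k)) atTop (𝓝 g) ↔
      Tendsto (fun k => eLpNorm (fun x => f k x - g x) 2 μ) atTop (𝓝 0) := by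
  rw [Lp.tendsto_Lp_iff_tendsto_eLpNorm']
  refine tendsto_congr fun k => eLpNorm_congr_ae ?_
  filter_upwards [(hf k).coeFn_toLp] with x hx
  simp [hx]

/-- The weak gradient clause is implied by the approximation clause, because having a weak gradient
is a closed condition. What is left is a closed linear subspace. -/
lemma IsLipschitzDomain.isH1_iff (hΩ : IsLipschitzDomain Ω) (f : L2 Ω) (G : L2v Ω) :
    IsH1 Ω f G ↔ (f, G) ∈ hΩ.sobolevSpace := by
  constructor
  · rintro ⟨-, φ, hφ, h1, h2⟩
    refine mem_closure_of_tendsto (f := fun k => hΩ.smoothPair ⟨φ k, mem_smoothFunctions.2 (hφ k)⟩) (b := atTop) ?_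
      (.of_forall fun k => ⟨_, rfl⟩)
    exact ((tendsto_toLp_iff (fun k => hΩ.memLp_restrict (hφ k).continuous) _).2 h1).prodMk_nhds ((tendsto_toLp_iff
      (fun k => hΩ.memLp_restrict (continuous_gradient (hφ k))) _).2 h2)
  · intro h
    refine ⟨hΩ.hasWeakGradient_of_mem_sobolevSpace h, ?_⟩
    obtain ⟨x, hx, hlim⟩ := mem_closure_iff_seq_limit.1 h
    choose φ hφ using hx
    obtain rfl : (fun k => hΩ.smoothPair (φ k)) = x := funext hφ
    exact ⟨fun k => (φ k).1, fun k => contDiff_smoothFunctions (φ k),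
      (tendsto_toLp_iff (fun k =>
        hΩ.memLp_restrict (contDiff_smoothFunctions (φ k)).continuous) _).1 hlim.fst_nhds,
      (tendsto_toLp_iff (fun k =>
        hΩ.memLp_restrict (continuous_gradient (contDiff_smoothFunctions (φ k)))) _).1 hlim.snd_nhds⟩

lemma IsLipschitzDomain.sobolevSpace_of_traceSpace (hΩ : IsLipschitzDomain Ω) {f : L2 Ω}
    {G : L2v Ω} {h : L2b Ω} (H : (f, G, h) ∈ hΩ.traceSpace) : (f, G) ∈ hΩ.sobolevSpace := by
  obtain ⟨x, hx, hlim⟩ := mem_closure_iff_seq_limit.1 H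
  choose φ hφ using hx
  obtain rfl : (fun k => hΩ.smoothTriple (φ k)) = x := funext hφ
  refine mem_closure_of_tendsto (f := fun k => hΩ.smoothPair (φ k)) (b := atTop) ?_
      (.of_forall fun k => ⟨_, rfl⟩)
  exact hlim.fst_nhds.prodMk_nhds hlim.snd_nhds.fst_nhds

lemma IsLipschitzDomain.hasTrace_iff (hΩ : IsLipschitzDomain Ω) (f : L2 Ω) (G : L2v Ω)
    (h : L2b Ω) : HasTrace Ω f G h ↔ (f, G, h) ∈ hΩ.traceSpace := by
  constructor
  · rintro ⟨-, φ, hφ, h1, h2, h3⟩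
    refine mem_closure_of_tendsto (f := fun k => hΩ.smoothTriple ⟨φ k, mem_smoothFunctions.2 (hφ k)⟩) (b := atTop) ?_
      (.of_forall fun k => ⟨_, rfl⟩)
    exact ((tendsto_toLp_iff (fun k => hΩ.memLp_restrict (hφ k).continuous) _).2 h1).prodMk_nhds
      (((tendsto_toLp_iff
      (fun k => hΩ.memLp_restrict (continuous_gradient (hφ k))) _).2 h2).prodMk_nhds ((tendsto_toLp_iff
      (fun k => hΩ.memLp_surf (hφ k).continuous) _).2 h3))
  · intro H
    refine ⟨hΩ.hasWeakGradient_of_mem_sobolevSpace (hΩ.sobolevSpace_of_traceSpace H), ?_⟩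
    obtain ⟨x, hx, hlim⟩ := mem_closure_iff_seq_limit.1 H
    choose φ hφ using hx
    obtain rfl : (fun k => hΩ.smoothTriple (φ k)) = x := funext hφ
    exact ⟨fun k => (φ k).1, fun k => contDiff_smoothFunctions (φ k),
      (tendsto_toLp_iff (fun k =>
        hΩ.memLp_restrict (contDiff_smoothFunctions (φ k)).continuous) _).1 hlim.fst_nhds,
      (tendsto_toLp_iff (fun k =>
        hΩ.memLp_restrict (continuous_gradient (contDiff_smoothFunctions (φ k)))) _).1 hlim.snd_nhds.fst_nhds,
      (tendsto_toLp_iff (fun k =>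
        hΩ.memLp_surf (contDiff_smoothFunctions (φ k)).continuous) _).1 hlim.snd_nhds.snd_nhds⟩

/-! ### Abstract evolution equations -/

section Evolution

variable {H K : Type*} [NormedAddCommGroup H] [InnerProductSpace ℝ H]
  [NormedAddCommGroup K] [NormedSpace ℝ K]

/-- The curve `w` solves `d/dt ⟨w, φ⟩ + a(w, φ) = 0`, `w(0) = u`, in weak form. The elements of the
form domain are pairs `(f, k) ∈ D`, where `k ∈ K` is the energy part of `f`, on which the form is
evaluated. -/
def IsEvolution (a : K →L[ℝ] K →L[ℝ] ℝ) (D : Submodule ℝ (H × K)) (u : H) (w : ℝ → H) : Prop :=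
  w 0 = u ∧ ContinuousOn w (Ici 0) ∧ ∃ y : ℝ → K,
    (∀ T > (0 : ℝ), MemLp y 2 (volume.restrict (Ioc 0 T))) ∧
    (∀ᵐ t ∂(volume.restrict (Ioi (0 : ℝ))), (w t, y t) ∈ D) ∧
    ∀ p ∈ D, ∀ t ≥ (0 : ℝ), inner ℝ (w t) p.1 - inner ℝ u p.1 + ∫ τ in (0 : ℝ)..t, a (y τ) p.2 = 0

variable {a : K →L[ℝ] K →L[ℝ] ℝ} {D : Submodule ℝ (H × K)}

lemma integrableOn_of_memLp_two {F : Type*} [NormedAddCommGroup F] {y : ℝ → F}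
    (hy : ∀ T > (0 : ℝ), MemLp y 2 (volume.restrict (Ioc 0 T))) (t : ℝ) :
    IntegrableOn y (Ioc 0 t) := by
  rcases le_or_gt t 0 with h | h
  · simp [Ioc_eq_empty (not_lt.2 h)]
  · exact (hy t h).integrable (by norm_num)

lemma intervalIntegrable_of_memLp_two {F : Type*} [NormedAddCommGroup F] {y : ℝ → F}
    (hy : ∀ T > (0 : ℝ), MemLp y 2 (volume.restrict (Ioc 0 T))) {t : ℝ} (ht : 0 ≤ t) :
    IntervalIntegrable y volume 0 t :=
  (intervalIntegrable_iff_integrableOn_Ioc_of_le ht).2 (integrableOn_of_memLp_two hy t)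

lemma intervalIntegrable_form (a : K →L[ℝ] K →L[ℝ] ℝ) {y : ℝ → K}
    (hy : ∀ T > (0 : ℝ), MemLp y 2 (volume.restrict (Ioc 0 T))) {t : ℝ} (ht : 0 ≤ t) (k : K) :
    IntervalIntegrable (fun τ => a (y τ) k) volume 0 t := by
  rw [intervalIntegrable_iff_integrableOn_Ioc_of_le ht]
  exact (a.flip k).integrable_comp (integrableOn_of_memLp_two hy t)

lemma IsEvolution.sub {u u' : H} {w w' : ℝ → H} (h : IsEvolution a D u w)
    (h' : IsEvolution a D u' w') : IsEvolution a D (u - u') (fun t => w t - w' t) := by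
  obtain ⟨h1, h2, y, h3, h4, h5⟩ := h
  obtain ⟨h1', h2', y', h3', h4', h5'⟩ := h'
  refine ⟨by simp only [h1, h1'], h2.sub h2', fun t => y t - y' t, fun T hT => (h3 T hT).sub (h3' T hT),
    ?_, ?_⟩
  · filter_upwards [h4, h4'] with t ht ht'
    exact D.sub_mem ht ht'
  · intro p hp t ht
    simp only [map_sub, sub_apply, inner_sub_left]
    rw [intervalIntegral.integral_sub (intervalIntegrable_form a h3 ht _)
      (intervalIntegrable_form a h3' ht _)]
    linarith [h5 p hp t ht, h5' p hp t ht]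

/-- Integrating a symmetric kernel over a triangle gives half of the integral over the square. -/
lemma integral_form_triangle [CompleteSpace K] (hsymm : ∀ x y, a x y = a y x) {T : ℝ} {y : ℝ → K}
    (hy : IntegrableOn y (Ioc 0 T)) :
    2 * ∫ t in Ioc 0 T, ∫ τ in (0 : ℝ)..t, a (y τ) (y t) =
      a (∫ t in Ioc 0 T, y t) (∫ t in Ioc 0 T, y t) := by
  set μ : Measure ℝ := volume.restrict (Ioc 0 T) with hμ
  have hy' : Integrable y μ := hy
  set F : ℝ × ℝ → ℝ := fun p => a (y p.2) (y p.1) with hF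
  have hFi : Integrable F (μ.prod μ) := by
    refine Integrable.mono' ((hy'.norm.mul_prod hy'.norm).const_mul ‖a‖) ?_ ?_
    · have h1 : AEStronglyMeasurable (fun p : ℝ × ℝ => (y p.2, y p.1)) (μ.prod μ) :=
        hy'.1.comp_snd.prodMk hy'.1.comp_fst
      exact (show Continuous fun q : K × K => a q.1 q.2 by fun_prop).comp_aestronglyMeasurable h1
    · refine .of_forall fun p => ?_
      refine (a.le_opNorm₂ _ _).trans (le_of_eq ?_)
      ring
  have hS : MeasurableSet {p : ℝ × ℝ | p.2 ≤ p.1} := measurableSet_le measurable_snd measurable_fst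
  have hS' : MeasurableSet {p : ℝ × ℝ | p.2 < p.1} := measurableSet_lt measurable_snd measurable_fst
  have e1 : ∫ t in Ioc 0 T, ∫ τ in (0 : ℝ)..t, a (y τ) (y t) =
      ∫ p, {p : ℝ × ℝ | p.2 ≤ p.1}.indicator F p ∂(μ.prod μ) := by
    rw [integral_prod _ (hFi.indicator hS)]
    refine setIntegral_congr_fun measurableSet_Ioc fun t ht => ?_
    have : (fun τ => {p : ℝ × ℝ | p.2 ≤ p.1}.indicator F (t, τ)) =
        (Iic t).indicator fun τ => a (y τ) (y t) := by
      ext τ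
      by_cases h : τ ≤ t <;> simp [indicator, h, hF]
    simp only [this]
    rw [integral_indicator measurableSet_Iic, hμ, Measure.restrict_restrict measurableSet_Iic,
      intervalIntegral.integral_of_le ht.1.le]
    congr 2
    ext τ
    simp only [mem_Ioc, mem_inter_iff, mem_Iic]
    exact ⟨fun h => ⟨h.2, h.1, h.2.trans ht.2⟩, fun h => ⟨h.2.1, h.1⟩⟩
  -- The same iterated integral over the strict triangle, since each slice changes by one point. Its
  -- reflection is exactly the complement of the closed triangle, so the two pieces tile the square
  -- without overlap.
  have e2 : ∫ t in Ioc 0 T, ∫ τ in (0 : ℝ)..t, a (y τ) (y t) =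
      ∫ p, {p : ℝ × ℝ | p.2 < p.1}.indicator F p ∂(μ.prod μ) := by
    rw [integral_prod _ (hFi.indicator hS')]
    refine setIntegral_congr_fun measurableSet_Ioc fun t ht => ?_
    have : (fun τ => {p : ℝ × ℝ | p.2 < p.1}.indicator F (t, τ)) =
        (Iio t).indicator fun τ => a (y τ) (y t) := by
      ext τ
      by_cases h : τ < t <;> simp [indicator, h, hF]
    simp only [this]
    rw [integral_indicator measurableSet_Iio, hμ, Measure.restrict_restrict measurableSet_Iio,
      intervalIntegral.integral_of_le ht.1.le, integral_Ioc_eq_integral_Ioo]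
    congr 2
    ext τ
    simp only [mem_Ioo, mem_Ioc, mem_inter_iff, mem_Iio]
    exact ⟨fun h => ⟨h.2, h.1, h.2.le.trans ht.2⟩, fun h => ⟨h.2.1, h.1⟩⟩
  have e3 : ∫ p, {p : ℝ × ℝ | p.2 < p.1}.indicator F p ∂(μ.prod μ) =
      ∫ p, {p : ℝ × ℝ | p.2 ≤ p.1}ᶜ.indicator F p ∂(μ.prod μ) := by
    rw [← integral_prod_swap]
    refine integral_congr_ae (.of_forall fun p => ?_)
    by_cases h : p.1 < p.2
    · simp [indicator, h, hF, hsymm (y p.1)]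
    · simp [indicator, h]
  have e4 : ∫ p, F p ∂(μ.prod μ) = a (∫ t, y t ∂μ) (∫ t, y t ∂μ) := by
    rw [integral_prod _ hFi]
    have : ∀ t, ∫ τ, F (t, τ) ∂μ = a (∫ τ, y τ ∂μ) (y t) := fun t =>
      (a.flip (y t)).integral_comp_comm hy'
    simp_rw [this]
    exact (a (∫ τ, y τ ∂μ)).integral_comp_comm hy'
  rw [← e4, two_mul]
  nth_rw 1 [e1]
  rw [e2, e3, ← integral_add (hFi.indicator hS) (hFi.indicator hS.compl)]
  refine integral_congr_ae (.of_forall fun p => ?_)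
  exact congrFun (indicator_self_add_compl _ F) p

/-- Testing with `w r` gives `‖w r‖² = -∫₀^r a (y τ) (y r) dτ` for almost every `r`. Integrated over
`(0, t)`, the right side is `-a(Y, Y)/2 ≤ 0` with `Y = ∫ y`. Hence `w` vanishes almost everywhere,
and everywhere by continuity. -/
lemma IsEvolution.eqOn_zero [CompleteSpace K] (hsymm : ∀ x y, a x y = a y x)
    (hpos : ∀ x, 0 ≤ a x x) {w : ℝ → H} (h : IsEvolution a D 0 w) : EqOn w 0 (Ici 0) := by
  obtain ⟨h1, h2, y, h3, h4, h5⟩ := h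
  intro t ht
  rcases eq_or_lt_of_le (mem_Ici.1 ht) with rfl | ht
  · exact h1
  have hsub : ContinuousOn w (Icc 0 t) := h2.mono Icc_subset_Ici_self
  have hae : ∀ᵐ r ∂(volume.restrict (Ioc 0 t)),
      ‖w r‖ ^ 2 = -∫ τ in (0 : ℝ)..r, a (y τ) (y r) := by
    filter_upwards [ae_restrict_of_ae_restrict_of_subset Ioc_subset_Ioi_self h4,
      ae_restrict_mem measurableSet_Ioc] with r hr hr'
    have := h5 _ hr r hr'.1.le
    simp only [real_inner_self_eq_norm_sq, inner_zero_left] at this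
    linarith
  have hint : ∫ r in Ioc 0 t, ‖w r‖ ^ 2 ≤ 0 := by
    rw [integral_congr_ae hae, integral_neg]
    have := integral_form_triangle hsymm (h3 t ht |>.integrable (by norm_num))
    have h6 := hpos (∫ t in Ioc 0 t, y t)
    linarith
  have hi : IntegrableOn (fun r => ‖w r‖ ^ 2) (Ioc 0 t) :=
    ((hsub.norm.pow 2).integrableOn_Icc).mono_set Ioc_subset_Icc_self
  have h0 : (fun r => ‖w r‖ ^ 2) =ᵐ[volume.restrict (Ioc 0 t)] 0 :=
    (integral_eq_zero_iff_of_nonneg (fun r => sq_nonneg _) hi).1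
      (le_antisymm hint (integral_nonneg fun r => sq_nonneg _))
  have h7 : w =ᵐ[volume.restrict (Icc 0 t)] 0 := by
    rw [← restrict_Ioc_eq_restrict_Icc]
    filter_upwards [h0] with r hr
    simpa using hr
  exact Measure.eqOn_Icc_of_ae_eq volume ht.ne h7 hsub continuousOn_const ⟨ht.le, le_rfl⟩

lemma IsEvolution.unique [CompleteSpace K] (hsymm : ∀ x y, a x y = a y x)
    (hpos : ∀ x, 0 ≤ a x x) {u : H} {w w' : ℝ → H} (h : IsEvolution a D u w)
    (h' : IsEvolution a D u w') : EqOn w w' (Ici 0) := by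
  have h0 := h.sub h'
  rw [sub_self] at h0
  exact fun t ht => sub_eq_zero.1 (h0.eqOn_zero hsymm hpos ht)

end Evolution

/-! ### Expansions in a Hilbert basis -/

section Expansion

variable {H : Type*} [NormedAddCommGroup H] [InnerProductSpace ℝ H] (b : HilbertBasis ℕ ℝ H)

lemma hasSum_expansion {d : ℕ → ℝ} (hd : Summable fun m => d m ^ 2) :
    ∃ v : H, HasSum (fun m => d m • b m) v ∧ (∀ m, inner ℝ (b m) v = d m) := by
  have hl : Memℓp d 2 := memℓp_gen (by simpa using hd)
  refine ⟨b.repr.symm ⟨d, hl⟩, b.hasSum_repr_symm ⟨d, hl⟩, fun m => ?_⟩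
  rw [← b.repr_apply_apply]
  simp

/-- The vector with coefficients `d`. -/
def expansion (d : ℕ → ℝ) : H := ∑' m, d m • b m

variable {b} in
lemma expansion_hasSum {d : ℕ → ℝ} (hd : Summable fun m => d m ^ 2) :
    HasSum (fun m => d m • b m) (expansion b d) :=
  (hasSum_expansion b hd).choose_spec.1.summable.hasSum

variable {b} in
lemma inner_expansion {d : ℕ → ℝ} (hd : Summable fun m => d m ^ 2) (m : ℕ) :
    inner ℝ (b m) (expansion b d) = d m := by
  obtain ⟨v, hv, h⟩ := hasSum_expansion b hd
  rw [expansion, hv.tsum_eq, h]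

variable {b} in
lemma expansion_hasSum_inner {d : ℕ → ℝ} (hd : Summable fun m => d m ^ 2) (f : H) :
    HasSum (fun m => d m * inner ℝ (b m) f) (inner ℝ (expansion b d) f) := by
  have := (innerSL ℝ f).hasSum (expansion_hasSum (b := b) hd)
  simp only [innerSL_apply_apply, inner_smul_right] at this
  simpa only [real_inner_comm f] using this

lemma eq_of_inner_basis {v w : H} (h : ∀ m, inner ℝ (b m) v = inner ℝ (b m) w) : v = w := by
  apply b.repr.injective
  ext m
  rw [b.repr_apply_apply, b.repr_apply_apply, h]

lemma hasSum_inner_basis_sq (v : H) : HasSum (fun m => inner ℝ (b m) v ^ 2) (‖v‖ ^ 2) := by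
  rw [← real_inner_self_eq_norm_sq]
  convert! b.hasSum_inner_mul_inner v v using 2 with m
  rw [sq, real_inner_comm v]

lemma expansion_inner (v : H) : expansion b (fun m => inner ℝ (b m) v) = v :=
  eq_of_inner_basis b fun m => inner_expansion (hasSum_inner_basis_sq b v).summable m

lemma summable_sq_of_le {d C : ℕ → ℝ} (hC : Summable fun m => C m ^ 2) (h : ∀ m, |d m| ≤ C m) :
    Summable fun m => d m ^ 2 :=
  hC.of_nonneg_of_le (fun _ => sq_nonneg _) fun m => sq_le_sq' (abs_le.1 (h m)).1 (abs_le.1 (h m)).2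

/-- Dominated convergence for expansions. -/
lemma tendsto_expansion {ι : Type*} {l : Filter ι} {d : ι → ℕ → ℝ} {e C : ℕ → ℝ}
    (hC : Summable fun m => C m ^ 2) (hd : ∀ᶠ i in l, ∀ m, |d i m| ≤ C m) (he : ∀ m, |e m| ≤ C m)
    (hlim : ∀ m, Tendsto (fun i => d i m) l (𝓝 (e m))) :
    Tendsto (fun i => expansion b (d i)) l (𝓝 (expansion b e)) := by
  rw [tendsto_iff_norm_sub_tendsto_zero]
  have h1 : Tendsto (fun i => ∑' m, (d i m - e m) ^ 2) l (𝓝 (∑' _ : ℕ, (0 : ℝ))) := by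
    refine tendsto_tsum_of_dominated_convergence (hC.mul_left 4) (fun m => ?_) ?_
    · have := ((hlim m).sub_const (e m)).pow 2
      simpa using this
    · filter_upwards [hd] with i hi m
      rw [Real.norm_of_nonneg (sq_nonneg _)]
      have h2 : |d i m - e m| ≤ 2 * C m := by
        have := abs_sub (d i m) (e m)
        linarith [hi m, he m]
      calc (d i m - e m) ^ 2 ≤ (2 * C m) ^ 2 := sq_le_sq' (abs_le.1 h2).1 (abs_le.1 h2).2
        _ = 4 * C m ^ 2 := by ring
  have h3 : ∀ᶠ i in l, ‖expansion b (d i) - expansion b e‖ = √(∑' m, (d i m - e m) ^ 2) := by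
    filter_upwards [hd] with i hi
    rw [← Real.sqrt_sq (norm_nonneg (expansion b (d i) - expansion b e)),
      ← (hasSum_inner_basis_sq b _).tsum_eq]
    simp_rw [inner_sub_right, inner_expansion (summable_sq_of_le hC hi),
      inner_expansion (summable_sq_of_le hC he)]
  refine Tendsto.congr' (h3.mono fun i h => h.symm) ?_
  have := (Real.continuous_sqrt.tendsto _).comp h1
  simpa [Function.comp_def] using this

end Expansion

/-! ### The scalar integrals -/

section Scalar

variable {s : ℝ}

lemma integrableOn_kernel (hs : 0 < s) {ε : ℝ} (hε : 0 < ε) :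
    IntegrableOn (fun t : ℝ => (t ^ (1 + s))⁻¹) (Ioi ε) := by
  refine (integrableOn_Ioi_rpow_of_lt (a := -(1 + s)) (by linarith) hε).congr_fun ?_
    measurableSet_Ioi
  intro t ht
  exact Real.rpow_neg (hε.trans ht).le _

/-- Near `0` the bound `1 - exp(-t) ≤ t` leaves `t^(-s)`, integrable as `s < 1`; at infinity
`t^(-1-s)` is integrable as `s > 0`. -/
lemma integrableOn_kernel_mul_exp_one (hs : s ∈ Ioo (0 : ℝ) 1) :
    IntegrableOn (fun t : ℝ => (t ^ (1 + s))⁻¹ * (1 - Real.exp (-t))) (Ioi 0) := by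
  have hm : Measurable fun t : ℝ => (t ^ (1 + s))⁻¹ * (1 - Real.exp (-t)) := by fun_prop
  rw [← Ioc_union_Ioi_eq_Ioi zero_le_one]
  refine IntegrableOn.union ?_ ?_
  · have h1 : IntegrableOn (fun t : ℝ => t ^ (-s)) (Ioc 0 1) :=
      (intervalIntegrable_iff_integrableOn_Ioc_of_le zero_le_one).1
        (intervalIntegral.intervalIntegrable_rpow' (by linarith [hs.2]))
    refine Integrable.mono' h1 hm.aestronglyMeasurable ?_
    filter_upwards [ae_restrict_mem measurableSet_Ioc] with t ht
    have h2 : 0 ≤ 1 - Real.exp (-t) := by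
      have := Real.exp_le_one_iff.2 (neg_nonpos.2 ht.1.le)
      linarith
    have h3 : 1 - Real.exp (-t) ≤ t := by linarith [Real.add_one_le_exp (-t)]
    have h4 : 0 < t ^ (1 + s) := Real.rpow_pos_of_pos ht.1 _
    rw [Real.norm_of_nonneg (by positivity)]
    calc (t ^ (1 + s))⁻¹ * (1 - Real.exp (-t)) ≤ (t ^ (1 + s))⁻¹ * t := by gcongr
      _ = t ^ (-s) := by
        rw [← Real.rpow_neg ht.1.le, ← Real.rpow_add_one ht.1.ne']
        congr 1
        ring
  · refine Integrable.mono' (integrableOn_kernel hs.1 one_pos) hm.aestronglyMeasurable ?_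
    filter_upwards [ae_restrict_mem measurableSet_Ioi] with t ht
    have ht0 : (0 : ℝ) < t := one_pos.trans ht
    have h2 : 0 ≤ 1 - Real.exp (-t) := by
      have := Real.exp_le_one_iff.2 (neg_nonpos.2 ht0.le)
      linarith
    have h4 : 0 < t ^ (1 + s) := Real.rpow_pos_of_pos ht0 _
    rw [Real.norm_of_nonneg (by positivity)]
    exact mul_le_of_le_one_right (by positivity) (by linarith [Real.exp_pos (-t)])

/-- Prepares the substitution `λ t`, which reduces `λ > 0` to `λ = 1`. The Jacobian `λ⁻¹` then turns
`λ^(1+s)` into `λ^s`. -/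
lemma kernel_mul_exp_scaling {lam t : ℝ} (hl : 0 < lam) (ht : 0 < t) :
    (t ^ (1 + s))⁻¹ * (1 - Real.exp (-(lam * t))) =
      lam ^ (1 + s) * (((lam * t) ^ (1 + s))⁻¹ * (1 - Real.exp (-(lam * t)))) := by
  rw [Real.mul_rpow hl.le ht.le]
  have h1 := (Real.rpow_pos_of_pos hl (1 + s)).ne'
  have h2 := (Real.rpow_pos_of_pos ht (1 + s)).ne'
  field_simp

lemma integrableOn_kernel_mul_exp (hs : s ∈ Ioo (0 : ℝ) 1) {lam : ℝ} (hl : 0 ≤ lam) :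
    IntegrableOn (fun t : ℝ => (t ^ (1 + s))⁻¹ * (1 - Real.exp (-(lam * t)))) (Ioi 0) := by
  rcases hl.eq_or_lt with rfl | hl
  · simp
  have h1 := (integrableOn_Ioi_comp_mul_left_iff
    (fun t : ℝ => (t ^ (1 + s))⁻¹ * (1 - Real.exp (-t))) 0 hl).2
    (by rw [mul_zero]; exact integrableOn_kernel_mul_exp_one hs)
  exact IntegrableOn.congr_fun (h1.const_mul (lam ^ (1 + s)))
    (fun t ht => (kernel_mul_exp_scaling hl ht).symm) measurableSet_Ioi

lemma integral_kernel_mul_exp (hs : s ∈ Ioo (0 : ℝ) 1) {lam : ℝ} (hl : 0 ≤ lam) :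
    ∫ t in Ioi (0 : ℝ), (t ^ (1 + s))⁻¹ * (1 - Real.exp (-(lam * t))) =
      lam ^ s * ∫ t in Ioi (0 : ℝ), (t ^ (1 + s))⁻¹ * (1 - Real.exp (-t)) := by
  rcases hl.eq_or_lt with rfl | hl
  · simp [Real.zero_rpow hs.1.ne']
  rw [setIntegral_congr_fun measurableSet_Ioi (fun t ht => kernel_mul_exp_scaling hl ht),
    integral_const_mul, integral_comp_mul_left_Ioi
      (fun t : ℝ => (t ^ (1 + s))⁻¹ * (1 - Real.exp (-t))) 0 hl, mul_zero, smul_eq_mul,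
    ← mul_assoc, Real.rpow_add hl, Real.rpow_one]
  field_simp

lemma kernel_mul_exp_nonneg {lam t : ℝ} (hl : 0 ≤ lam) (ht : 0 < t) :
    0 ≤ (t ^ (1 + s))⁻¹ * (1 - Real.exp (-(lam * t))) := by
  have h2 : 0 ≤ 1 - Real.exp (-(lam * t)) := by
    have := Real.exp_le_one_iff.2 (neg_nonpos.2 (mul_nonneg hl ht.le))
    linarith
  have h4 : 0 < t ^ (1 + s) := Real.rpow_pos_of_pos ht _
  positivity

/-- The bound is uniform in `ε` and serves as the dominating sequence in `tendsto_frac_semigroup`.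
-/
lemma abs_integral_kernel_mul_exp_le (hs : s ∈ Ioo (0 : ℝ) 1) {lam ε : ℝ} (hl : 0 ≤ lam)
    (hε : 0 ≤ ε) :
    |∫ t in Ioi ε, (t ^ (1 + s))⁻¹ * (1 - Real.exp (-(lam * t)))| ≤
      lam ^ s * ∫ t in Ioi (0 : ℝ), (t ^ (1 + s))⁻¹ * (1 - Real.exp (-t)) := by
  rw [← integral_kernel_mul_exp hs hl, abs_of_nonneg (setIntegral_nonneg measurableSet_Ioi
    fun t ht => kernel_mul_exp_nonneg hl (hε.trans_lt ht))]
  refine setIntegral_mono_set (integrableOn_kernel_mul_exp hs hl) ?_ (Ioi_subset_Ioi hε).eventuallyLE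
  filter_upwards [ae_restrict_mem measurableSet_Ioi] with t ht
  exact kernel_mul_exp_nonneg hl ht

lemma tendsto_integral_kernel_mul_exp (hs : s ∈ Ioo (0 : ℝ) 1) {lam : ℝ} (hl : 0 ≤ lam) :
    Tendsto (fun ε => ∫ t in Ioi ε, (t ^ (1 + s))⁻¹ * (1 - Real.exp (-(lam * t)))) (𝓝[>] 0)
      (𝓝 (∫ t in Ioi (0 : ℝ), (t ^ (1 + s))⁻¹ * (1 - Real.exp (-(lam * t))))) := by
  have hc : AECover (volume.restrict (Ioi (0 : ℝ))) (𝓝[>] (0 : ℝ)) fun ε => Ioi ε :=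
    aecover_Ioi_of_Ioi (tendsto_id.mono_left nhdsWithin_le_nhds)
  refine (hc.integral_tendsto_of_countably_generated (integrableOn_kernel_mul_exp hs hl)).congr' ?_
  filter_upwards [self_mem_nhdsWithin] with ε hε
  rw [Measure.restrict_restrict measurableSet_Ioi, inter_eq_left.2 (Ioi_subset_Ioi (le_of_lt hε))]

end Scalar

/-! ### Solving the abstract evolution equation with a basis of eigenvectors -/

section Spectral

variable {H K : Type*} [NormedAddCommGroup H] [InnerProductSpace ℝ H]
  [NormedAddCommGroup K] [NormedSpace ℝ K]

/-- An orthonormal basis of eigenvectors of the form `a` with domain `D`; `k m` is the energy part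
of `b m`. -/
structure IsEigenbasis (a : K →L[ℝ] K →L[ℝ] ℝ) (D : Submodule ℝ (H × K))
    (b : HilbertBasis ℕ ℝ H) (k : ℕ → K) (lam : ℕ → ℝ) : Prop where
  mem : ∀ m, (b m, k m) ∈ D
  eq : ∀ m, ∀ p ∈ D, a (k m) p.2 = lam m * inner ℝ (b m) p.1

variable {a : K →L[ℝ] K →L[ℝ] ℝ} {D : Submodule ℝ (H × K)} {b : HilbertBasis ℕ ℝ H} {k : ℕ → K}
  {lam : ℕ → ℝ}

lemma IsEigenbasis.form_apply (h : IsEigenbasis a D b k lam) (m j : ℕ) :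
    a (k m) (k j) = if m = j then lam m else 0 := by
  rw [h.eq m _ (h.mem j)]
  have := orthonormal_iff_ite.1 b.orthonormal m j
  simp only [this]
  split_ifs <;> simp

lemma IsEigenbasis.nonneg (h : IsEigenbasis a D b k lam) (hpos : ∀ x, 0 ≤ a x x) (m : ℕ) :
    0 ≤ lam m := by
  simpa [h.form_apply] using hpos (k m)

lemma IsEigenbasis.form_sum (h : IsEigenbasis a D b k lam) (d : ℕ → ℝ) (F : Finset ℕ) :
    a (∑ m ∈ F, d m • k m) (∑ m ∈ F, d m • k m) = ∑ m ∈ F, lam m * d m ^ 2 := by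
  simp only [map_sum, map_smul, sum_apply, smul_apply, h.form_apply, smul_eq_mul]
  refine Finset.sum_congr rfl fun m hm => ?_
  simp only [mul_ite, mul_zero]
  rw [Finset.sum_ite_eq' F m]
  simp only [hm, if_true]
  ring

variable {c : ℝ}

/-- The energy parts `k m` are orthogonal for `a`, so the form of a sum is a sum of squares, and
coercivity on `K` controls the norm. -/
lemma IsEigenbasis.norm_sum_sq_le (h : IsEigenbasis a D b k lam) (hc : 0 < c)
    (hco : ∀ x, c * ‖x‖ ^ 2 ≤ a x x) (d : ℕ → ℝ) (F : Finset ℕ) :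
    ‖∑ m ∈ F, d m • k m‖ ^ 2 ≤ c⁻¹ * ∑ m ∈ F, lam m * d m ^ 2 := by
  rw [← h.form_sum, inv_mul_eq_div, le_div_iff₀ hc, mul_comm]
  exact hco _

lemma IsEigenbasis.summable_smul [CompleteSpace K] (h : IsEigenbasis a D b k lam) (hc : 0 < c)
    (hco : ∀ x, c * ‖x‖ ^ 2 ≤ a x x) {d : ℕ → ℝ} (hd : Summable fun m => lam m * d m ^ 2) :
    Summable fun m => d m • k m := by
  rw [summable_iff_vanishing_norm]
  intro ε hε
  obtain ⟨s, hs⟩ := summable_iff_vanishing_norm.1 hd (c * ε ^ 2) (by positivity)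
  refine ⟨s, fun t ht => ?_⟩
  have h1 := h.norm_sum_sq_le hc hco d t
  have h2 := (le_abs_self _).trans_lt (hs t ht)
  have h3 : ‖∑ m ∈ t, d m • k m‖ ^ 2 < ε ^ 2 := by
    refine h1.trans_lt ?_
    rw [inv_mul_eq_div, div_lt_iff₀ hc, mul_comm]
    exact h2
  exact lt_of_pow_lt_pow_left₀ 2 hε.le h3

lemma IsEigenbasis.norm_tsum_sq_le [CompleteSpace K] (h : IsEigenbasis a D b k lam) (hc : 0 < c)
    (hco : ∀ x, c * ‖x‖ ^ 2 ≤ a x x) {d : ℕ → ℝ} (hd : Summable fun m => lam m * d m ^ 2) :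
    ‖∑' m, d m • k m‖ ^ 2 ≤ c⁻¹ * ∑' m, lam m * d m ^ 2 := by
  refine le_of_tendsto_of_tendsto' ((h.summable_smul hc hco hd).hasSum.norm.pow 2)
    (hd.hasSum.const_mul c⁻¹) fun F => h.norm_sum_sq_le hc hco d F

/-- From `x exp(-x) ≤ 1`. This is the smoothing effect: for `t > 0` the energy series converges
whatever the initial value. -/
lemma mul_exp_sq_le {l x t : ℝ} (hl : 0 ≤ l) (ht : 0 < t) :
    l * (Real.exp (-(l * t)) * x) ^ 2 ≤ t⁻¹ * x ^ 2 := by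
  have h1 : Real.exp (-(l * t)) ≤ 1 := Real.exp_le_one_iff.2 (by nlinarith)
  have h2 : l * t * Real.exp (-(l * t)) ≤ 1 := by
    have := Real.add_one_le_exp (l * t)
    rw [Real.exp_neg, ← div_eq_mul_inv, div_le_one (Real.exp_pos _)]
    linarith
  have h3 : l * Real.exp (-(l * t)) ≤ t⁻¹ := by
    rw [← one_div, le_div_iff₀ ht]
    linarith
  have h4 : l * Real.exp (-(l * t)) * Real.exp (-(l * t)) ≤ t⁻¹ * 1 := by
    gcongr
  calc l * (Real.exp (-(l * t)) * x) ^ 2 =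
      l * Real.exp (-(l * t)) * Real.exp (-(l * t)) * x ^ 2 := by ring
    _ ≤ t⁻¹ * 1 * x ^ 2 := by gcongr
    _ = _ := by ring

lemma integral_mul_exp_neg (l t : ℝ) :
    ∫ τ in (0 : ℝ)..t, l * Real.exp (-(l * τ)) = 1 - Real.exp (-(l * t)) := by
  have hd : ∀ x ∈ uIcc 0 t, HasDerivAt (fun τ => -Real.exp (-(l * τ))) (l * Real.exp (-(l * x))) x := by
    intro x _
    have := (((hasDerivAt_id x).const_mul l).neg.exp).neg
    convert! this using 1
    simp only [Pi.neg_apply, id]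
    ring
  rw [intervalIntegral.integral_eq_sub_of_hasDerivAt hd (by
    apply Continuous.intervalIntegrable; fun_prop)]
  simp
  ring

variable (b lam) in
/-- The heat semigroup `∑ exp(-λ t) ⟨u, φ⟩ φ`. -/
def semigroup (u : H) (t : ℝ) : H :=
  expansion b fun m => Real.exp (-(lam m * t)) * inner ℝ (b m) u

lemma abs_exp_mul_le {l t : ℝ} (hl : 0 ≤ l) (ht : 0 ≤ t) (x : ℝ) :
    |Real.exp (-(l * t)) * x| ≤ |x| := by
  rw [abs_mul, abs_of_pos (Real.exp_pos _)]
  exact mul_le_of_le_one_left (abs_nonneg _) (Real.exp_le_one_iff.2 (by nlinarith))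

lemma summable_abs_inner_sq (b : HilbertBasis ℕ ℝ H) (u : H) :
    Summable fun m => |inner ℝ (b m) u| ^ 2 := by
  simpa using (hasSum_inner_basis_sq b u).summable

lemma summable_semigroup (hl : ∀ m, 0 ≤ lam m) (u : H) {t : ℝ} (ht : 0 ≤ t) :
    Summable fun m => (Real.exp (-(lam m * t)) * inner ℝ (b m) u) ^ 2 :=
  summable_sq_of_le (summable_abs_inner_sq b u) fun m => abs_exp_mul_le (hl m) ht _

lemma semigroup_zero (u : H) : semigroup b lam u 0 = u := by
  simp [semigroup, expansion_inner]

lemma continuousOn_semigroup (hl : ∀ m, 0 ≤ lam m) (u : H) :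
    ContinuousOn (semigroup b lam u) (Ici 0) := by
  intro t ht
  refine tendsto_expansion b (summable_abs_inner_sq b u) ?_
    (fun m => abs_exp_mul_le (hl m) ht _) fun m => ?_
  · filter_upwards [self_mem_nhdsWithin] with r hr m using abs_exp_mul_le (hl m) hr _
  · refine Tendsto.mono_left (Continuous.tendsto ?_ t) nhdsWithin_le_nhds
    fun_prop

lemma norm_semigroup_le (hl : ∀ m, 0 ≤ lam m) (u : H) {t : ℝ} (ht : 0 ≤ t) :
    ‖semigroup b lam u t‖ ≤ ‖u‖ := by
  refine le_of_sq_le_sq ?_ (norm_nonneg _)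
  rw [← (hasSum_inner_basis_sq b u).tsum_eq, ← (hasSum_inner_basis_sq b _).tsum_eq]
  simp_rw [semigroup, inner_expansion (summable_semigroup hl u ht)]
  refine (summable_semigroup hl u ht).tsum_le_tsum (fun m => ?_)
    (hasSum_inner_basis_sq b u).summable
  exact sq_le_sq.2 (abs_exp_mul_le (hl m) ht _)

/-- The energy part is the same series with `k m` in place of `b m`. Membership in `D` follows from
closedness, square integrability in time from a bound mode by mode, and the weak equation from
integrating the series term by term. -/
lemma IsEigenbasis.isEvolution_semigroup [CompleteSpace K] (h : IsEigenbasis a D b k lam)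
    (hD : IsClosed (D : Set (H × K))) (hc : 0 < c) (hco : ∀ x, c * ‖x‖ ^ 2 ≤ a x x) (u : H) :
    IsEvolution a D u (semigroup b lam u) := by
  have hl : ∀ m, 0 ≤ lam m :=
    h.nonneg fun x => (by positivity : 0 ≤ c * ‖x‖ ^ 2).trans (hco x)
  set q : ℕ → ℝ := fun m => inner ℝ (b m) u with hq
  have hq2 : Summable fun m => q m ^ 2 := (hasSum_inner_basis_sq b u).summable
  have hs : ∀ t > 0, Summable fun m => lam m * (Real.exp (-(lam m * t)) * q m) ^ 2 := fun t ht =>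
    (hq2.mul_left t⁻¹).of_nonneg_of_le (fun m => mul_nonneg (hl m) (sq_nonneg _))
      fun m => mul_exp_sq_le (hl m) ht
  have hsum : ∀ t > 0, HasSum (fun m => (Real.exp (-(lam m * t)) * q m) • k m)
      (∑' m, (Real.exp (-(lam m * t)) * q m) • k m) := fun t ht =>
    (h.summable_smul hc hco (hs t ht)).hasSum
  refine ⟨semigroup_zero u, continuousOn_semigroup hl u,
    fun t => ∑' m, (Real.exp (-(lam m * t)) * q m) • k m, fun T hT => ?_, ?_, ?_⟩
  · have hmeas : AEStronglyMeasurable (fun t => ∑' m, (Real.exp (-(lam m * t)) * q m) • k m)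
        (volume.restrict (Ioc 0 T)) := by
      refine aestronglyMeasurable_of_tendsto_ae atTop
        (f := fun N t => ∑ m ∈ Finset.range N, (Real.exp (-(lam m * t)) * q m) • k m)
        (fun N => Continuous.aestronglyMeasurable (by fun_prop)) ?_
      filter_upwards [ae_restrict_mem measurableSet_Ioc] with t ht
      exact (hsum t ht.1).tendsto_sum_nat
    rw [memLp_two_iff_integrable_sq_norm hmeas]
    refine ⟨hmeas.norm.pow 2, ?_⟩
    rw [hasFiniteIntegral_iff_ofReal (.of_forall fun t => sq_nonneg _)]
    have hbound : ∀ᵐ t ∂(volume.restrict (Ioc 0 T)),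
        ENNReal.ofReal (‖∑' m, (Real.exp (-(lam m * t)) * q m) • k m‖ ^ 2) ≤
          ∑' m, ENNReal.ofReal (c⁻¹ * (lam m * (Real.exp (-(lam m * t)) * q m) ^ 2)) := by
      filter_upwards [ae_restrict_mem measurableSet_Ioc] with t ht
      rw [← ENNReal.ofReal_tsum_of_nonneg (fun m => mul_nonneg (inv_nonneg.2 hc.le)
        (mul_nonneg (hl m) (sq_nonneg _))) ((hs t ht.1).mul_left _), tsum_mul_left]
      exact ENNReal.ofReal_le_ofReal (h.norm_tsum_sq_le hc hco (hs t ht.1))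
    refine (lintegral_mono_ae hbound).trans_lt ?_
    rw [lintegral_tsum fun m =>
      (Continuous.measurable (by fun_prop)).ennreal_ofReal.aemeasurable]
    -- One factor `exp(-λ t)` is bounded by `1`, and `λ exp(-λ t)` has integral at most `1`. The
    -- bound is thus free of `λ` and `T`, and it is summable in `m`.
    have hterm : ∀ m, ∫⁻ t in Ioc 0 T,
        ENNReal.ofReal (c⁻¹ * (lam m * (Real.exp (-(lam m * t)) * q m) ^ 2)) ≤
          ENNReal.ofReal (c⁻¹ * q m ^ 2) := by
      intro m
      rw [← ofReal_integral_eq_lintegral_ofReal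
        ((Continuous.integrableOn_Icc (by fun_prop)).mono_set Ioc_subset_Icc_self)
        (.of_forall fun t => mul_nonneg (inv_nonneg.2 hc.le) (mul_nonneg (hl m) (sq_nonneg _)))]
      refine ENNReal.ofReal_le_ofReal ?_
      have h1 : ∫ t in Ioc 0 T, c⁻¹ * (lam m * (Real.exp (-(lam m * t)) * q m) ^ 2) ≤
          ∫ t in Ioc 0 T, c⁻¹ * q m ^ 2 * (lam m * Real.exp (-(lam m * t))) := by
        refine setIntegral_mono_on
          ((Continuous.integrableOn_Icc (by fun_prop)).mono_set Ioc_subset_Icc_self)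
          ((Continuous.integrableOn_Icc (by fun_prop)).mono_set Ioc_subset_Icc_self)
          measurableSet_Ioc fun t ht => ?_
        have h2 : Real.exp (-(lam m * t)) ≤ 1 :=
          Real.exp_le_one_iff.2 (neg_nonpos.2 (mul_nonneg (hl m) ht.1.le))
        have h3 : 0 ≤ c⁻¹ * q m ^ 2 * (lam m * Real.exp (-(lam m * t))) := by
          have := hl m
          positivity
        calc c⁻¹ * (lam m * (Real.exp (-(lam m * t)) * q m) ^ 2) =
            c⁻¹ * q m ^ 2 * (lam m * Real.exp (-(lam m * t))) * Real.exp (-(lam m * t)) := by ring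
          _ ≤ _ := mul_le_of_le_one_right h3 h2
      refine h1.trans ?_
      rw [integral_const_mul, ← intervalIntegral.integral_of_le hT.le, integral_mul_exp_neg]
      exact mul_le_of_le_one_right (by positivity) (by linarith [Real.exp_pos (-(lam m * T))])
    refine (ENNReal.tsum_le_tsum hterm).trans_lt ?_
    exact lt_top_iff_ne_top.2 (hq2.mul_left c⁻¹).tsum_ofReal_ne_top
  · filter_upwards [ae_restrict_mem measurableSet_Ioi] with t ht
    have h1 := (expansion_hasSum (b := b) (summable_semigroup (b := b) hl u (le_of_lt ht))).prodMk
      (hsum t ht)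
    refine hD.mem_of_tendsto h1 (.of_forall fun F => ?_)
    exact D.sum_mem fun m _ => D.smul_mem (Real.exp (-(lam m * t)) * q m) (h.mem m)
  · intro p hp t ht
    set r : ℕ → ℝ := fun m => q m * inner ℝ (b m) p.1 with hr
    have hrs : HasSum r (inner ℝ u p.1) := by
      simpa only [hr, hq, real_inner_comm u] using b.hasSum_inner_mul_inner u p.1
    have hwt : HasSum (fun m => Real.exp (-(lam m * t)) * r m)
        (inner ℝ (semigroup b lam u t) p.1) := by
      convert! expansion_hasSum_inner (b := b) (summable_semigroup hl u ht) p.1 using 2 with m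
      simp only [hr, hq]
      ring
    have hF : ∀ m, ∫ τ in Ioc 0 t, r m * (lam m * Real.exp (-(lam m * τ))) =
        r m * (1 - Real.exp (-(lam m * t))) := by
      intro m
      rw [integral_const_mul, ← intervalIntegral.integral_of_le ht, integral_mul_exp_neg]
    have hFn : ∀ m, ∫ τ in Ioc 0 t, ‖r m * (lam m * Real.exp (-(lam m * τ)))‖ ≤ |r m| := by
      intro m
      have : ∀ τ, ‖r m * (lam m * Real.exp (-(lam m * τ)))‖ =
          |r m| * (lam m * Real.exp (-(lam m * τ))) := by
        intro τ
        rw [norm_mul, Real.norm_eq_abs,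
          Real.norm_of_nonneg (mul_nonneg (hl m) (Real.exp_pos _).le)]
      simp_rw [this]
      rw [integral_const_mul, ← intervalIntegral.integral_of_le ht, integral_mul_exp_neg]
      exact mul_le_of_le_one_right (abs_nonneg _) (by linarith [Real.exp_pos (-(lam m * t))])
    -- Sum and integral may be exchanged because the products `r m` of the coefficients of `u` and
    -- `p.1` are absolutely summable.
    have key := hasSum_integral_of_summable_integral_norm (μ := volume.restrict (Ioc 0 t))
      (F := fun m τ => r m * (lam m * Real.exp (-(lam m * τ))))
      (fun m => (Continuous.integrableOn_Icc (by fun_prop)).mono_set Ioc_subset_Icc_self)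
      (hrs.summable.abs.of_nonneg_of_le (fun m => integral_nonneg fun τ => norm_nonneg _) hFn)
    simp only [hF] at key
    have hint : ∫ τ in (0 : ℝ)..t, a (∑' m, (Real.exp (-(lam m * τ)) * q m) • k m) p.2 =
        ∫ τ in Ioc 0 t, ∑' m, r m * (lam m * Real.exp (-(lam m * τ))) := by
      rw [intervalIntegral.integral_of_le ht]
      refine setIntegral_congr_fun measurableSet_Ioc fun τ hτ => ?_
      have h1 := (a.flip p.2).hasSum (hsum τ hτ.1)
      simp only [map_smul, ContinuousLinearMap.flip_apply, h.eq _ p hp, smul_eq_mul] at h1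
      rw [← h1.tsum_eq]
      refine tsum_congr fun m => ?_
      simp only [hr]
      ring
    rw [hint]
    have h2 : HasSum (fun m => r m * (1 - Real.exp (-(lam m * t))))
        (inner ℝ u p.1 - inner ℝ (semigroup b lam u t) p.1) := by
      convert! hrs.sub hwt using 2 with m
      ring
    rw [key.unique h2]
    ring

/-! ### The fractional integral of the semigroup -/

lemma integrableOn_frac_semigroup {s : ℝ} (hs : 0 < s) (hl : ∀ m, 0 ≤ lam m) (u : H) {ε : ℝ}
    (hε : 0 < ε) :
    IntegrableOn (fun t : ℝ => (t ^ (1 + s))⁻¹ • (semigroup b lam u t - u)) (Ioi ε) := by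
  have hcont : ContinuousOn (fun t : ℝ => (t ^ (1 + s))⁻¹ • (semigroup b lam u t - u)) (Ioi ε) := by
    refine ContinuousOn.smul (ContinuousOn.inv₀ (ContinuousOn.rpow_const continuousOn_id
      fun t ht => Or.inl (hε.trans ht).ne') fun t ht =>
        (Real.rpow_pos_of_pos (hε.trans ht) _).ne') ?_
    exact ((continuousOn_semigroup hl u).mono fun t ht => (hε.trans ht).le).sub continuousOn_const
  refine Integrable.mono' ((integrableOn_kernel hs hε).mul_const (2 * ‖u‖))
    (hcont.aestronglyMeasurable measurableSet_Ioi) ?_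
  filter_upwards [ae_restrict_mem measurableSet_Ioi] with t ht
  have h1 : 0 < t ^ (1 + s) := Real.rpow_pos_of_pos (hε.trans ht) _
  rw [norm_smul, Real.norm_of_nonneg (by positivity)]
  gcongr
  refine (norm_sub_le _ _).trans ?_
  linarith [norm_semigroup_le (b := b) hl u (hε.trans ht).le]

/-- The coefficient of the truncated integral along `b m` is `-⟨b m, u⟩` times a scalar integral
bounded by `λ^s J`. The hypothesis on `u` says exactly that these bounds are square summable. -/
lemma tendsto_frac_semigroup [CompleteSpace H] {s : ℝ} (hs : s ∈ Ioo (0 : ℝ) 1)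
    (hl : ∀ m, 0 ≤ lam m) {u : H} (hu : Summable fun m => lam m ^ (2 * s) * inner ℝ (b m) u ^ 2) :
    ∃ f, Tendsto (fun ε : ℝ => ∫ t in Ioi ε, (t ^ (1 + s))⁻¹ • (semigroup b lam u t - u))
      (𝓝[>] 0) (𝓝 f) := by
  set J : ℝ := ∫ t in Ioi (0 : ℝ), (t ^ (1 + s))⁻¹ * (1 - Real.exp (-t)) with hJ
  set A : ℝ → ℕ → ℝ := fun ε m =>
    -(∫ t in Ioi ε, (t ^ (1 + s))⁻¹ * (1 - Real.exp (-(lam m * t)))) * inner ℝ (b m) u with hA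
  set C : ℕ → ℝ := fun m => lam m ^ s * J * |inner ℝ (b m) u| with hC
  have hCs : Summable fun m => C m ^ 2 := by
    refine (hu.mul_left (J ^ 2)).congr fun m => ?_
    simp only [hC]
    rw [mul_pow, mul_pow, sq_abs, mul_comm 2 s, Real.rpow_mul (hl m)]
    norm_cast
    ring
  have hAC : ∀ ε, 0 ≤ ε → ∀ m, |A ε m| ≤ C m := by
    intro ε hε m
    simp only [hA, hC]
    rw [abs_mul, abs_neg]
    gcongr
    exact abs_integral_kernel_mul_exp_le hs (hl m) hε
  refine ⟨expansion b (A 0), ?_⟩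
  refine Tendsto.congr' ?_ (tendsto_expansion b (l := 𝓝[>] (0 : ℝ)) (d := A) hCs
    (by filter_upwards [self_mem_nhdsWithin] with ε hε m using hAC ε (le_of_lt hε) m)
    (hAC 0 le_rfl)
    fun m => (tendsto_integral_kernel_mul_exp hs (hl m)).neg.mul_const _)
  filter_upwards [self_mem_nhdsWithin] with ε hε
  have hε : 0 < ε := hε
  refine eq_of_inner_basis b fun m => ?_
  rw [inner_expansion (summable_sq_of_le hCs (hAC ε hε.le)),
    ← integral_inner (integrableOn_frac_semigroup hs.1 hl u hε)]
  simp only [hA]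
  rw [← integral_neg, ← integral_mul_const]
  refine setIntegral_congr_fun measurableSet_Ioi fun t ht => ?_
  simp only [inner_smul_right, inner_sub_right]
  rw [semigroup, inner_expansion (summable_semigroup hl u (hε.trans ht).le)]
  ring

end Spectral

/-! ### The energy as a bounded bilinear form -/

/-- Multiplication by a bounded function on `L²`. -/
lemma exists_mulL2 {α : Type*} {m : MeasurableSpace α} {μ : Measure α} {κ : α → ℝ}
    (hκ : AEStronglyMeasurable κ μ) {C : ℝ} (hC : ∀ᵐ x ∂μ, |κ x| ≤ C) :
    ∃ T : Lp ℝ 2 μ →L[ℝ] Lp ℝ 2 μ, ∀ h, T h =ᵐ[μ] fun x => κ x * h x := by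
  have hb : ∀ h : Lp ℝ 2 μ, ∀ᵐ x ∂μ, ‖κ x * h x‖ ≤ C * ‖h x‖ := fun h => by
    filter_upwards [hC] with x hx
    rw [norm_mul, Real.norm_eq_abs (κ x)]
    gcongr
  have hm : ∀ h : Lp ℝ 2 μ, MemLp (fun x => κ x * h x) 2 μ := fun h =>
    (Lp.memLp h).of_le_mul (hκ.mul (Lp.aestronglyMeasurable h)) (hb h)
  let T₀ : Lp ℝ 2 μ →ₗ[ℝ] Lp ℝ 2 μ :=
    { toFun := fun h => (hm h).toLp _
      map_add' := fun h h' => by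
        rw [← MemLp.toLp_add]
        refine MemLp.toLp_congr _ _ ?_
        filter_upwards [Lp.coeFn_add h h'] with x hx
        simp only [hx, Pi.add_apply, mul_add]
      map_smul' := fun c h => by
        rw [RingHom.id_apply, ← MemLp.toLp_const_smul]
        refine MemLp.toLp_congr _ _ ?_
        filter_upwards [Lp.coeFn_smul c h] with x hx
        simp only [hx, Pi.smul_apply, smul_eq_mul]
        ring }
  refine ⟨T₀.mkContinuous C fun h => ?_, fun h => (hm h).coeFn_toLp⟩
  refine Lp.norm_le_mul_norm_of_ae_le_mul ?_
  filter_upwards [hb h, (hm h).coeFn_toLp] with x hx hx'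
  rw [show T₀ h x = _ from hx']
  exact hx

/-- The inner product of a real inner product space as a bounded bilinear form. -/
def innerForm (F : Type*) [NormedAddCommGroup F] [InnerProductSpace ℝ F] : F →L[ℝ] F →L[ℝ] ℝ :=
  (isBoundedBilinearMap_inner (𝕜 := ℝ) (E := F)).toContinuousLinearMap

@[simp]
lemma innerForm_apply {F : Type*} [NormedAddCommGroup F] [InnerProductSpace ℝ F] (x y : F) :
    innerForm F x y = inner ℝ x y := rfl

/-- By compactness of the boundary `κ` is bounded there and bounded below by some `c > 0`. The form
is coercive on pairs (gradient, trace), so no Poincaré inequality is involved. -/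
lemma exists_robinForm (hΩ : IsLipschitzDomain Ω) {κ : E n → ℝ}
    (hκ : (BoundaryOp.robin κ).Regular Ω) :
    ∃ (A : (L2v Ω × L2b Ω) →L[ℝ] (L2v Ω × L2b Ω) →L[ℝ] ℝ) (c : ℝ), 0 < c ∧
      (∀ x, c * ‖x‖ ^ 2 ≤ A x x) ∧ (∀ x y, A x y = A y x) ∧
      ∀ G h G' h', energy Ω (.robin κ) G h G' h' = A (G, h) (G', h') := by
  obtain ⟨hκ, hpos⟩ := hκ
  obtain ⟨C, hC⟩ := hΩ.isCompact_frontier.exists_bound_of_continuousOn hκ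
  obtain ⟨c, hc, hcκ⟩ := hΩ.isCompact_frontier.exists_forall_le' hκ hpos
  obtain ⟨T, hT⟩ := exists_mulL2 (μ := surf Ω)
    (hκ.aestronglyMeasurable isClosed_frontier.measurableSet)
    ((ae_surf_mem_frontier Ω).mono fun x hx => hC x hx)
  have hin : ∀ h h' : L2b Ω, ∫ x, κ x * (h x * h' x) ∂(surf Ω) = inner ℝ (T h) h' := by
    intro h h'
    rw [L2.inner_def]
    refine integral_congr_ae ?_
    filter_upwards [hT h] with x hx
    simp only [hx, RCLike.inner_apply, conj_trivial]
    ring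
  let p₁ := ContinuousLinearMap.fst ℝ (L2v Ω) (L2b Ω)
  let p₂ := ContinuousLinearMap.snd ℝ (L2v Ω) (L2b Ω)
  let A : (L2v Ω × L2b Ω) →L[ℝ] (L2v Ω × L2b Ω) →L[ℝ] ℝ :=
    (innerForm (L2v Ω)).bilinearComp p₁ p₁ + (innerForm (L2b Ω)).bilinearComp (T.comp p₂) p₂
  have hA : ∀ x y, A x y = inner ℝ x.1 y.1 + inner ℝ (T x.2) y.2 := fun x y => rfl
  -- The gradient part has coercivity constant `1` and the trace part `c`; the square of the maximum
  -- norm on the product is at most the sum of the squares.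
  refine ⟨A, min 1 c, lt_min one_pos hc, fun x => ?_, fun x y => ?_, fun G h G' h' => ?_⟩
  · have h1 : c * ‖x.2‖ ^ 2 ≤ inner ℝ (T x.2) x.2 := by
      rw [← real_inner_self_eq_norm_sq, L2.inner_def, L2.inner_def, ← integral_const_mul]
      refine integral_mono_ae ((L2.integrable_inner _ _).const_mul c) (L2.integrable_inner _ _) ?_
      filter_upwards [hT x.2, ae_surf_mem_frontier Ω] with p hp hp'
      simp only [hp, RCLike.inner_apply, conj_trivial]
      nlinarith [hcκ p hp', mul_self_nonneg (x.2 p)]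
    rw [hA, real_inner_self_eq_norm_sq]
    have h2 : ‖x‖ ^ 2 ≤ ‖x.1‖ ^ 2 + ‖x.2‖ ^ 2 := by
      rw [Prod.norm_def]
      rcases max_cases ‖x.1‖ ‖x.2‖ with h | h <;> rw [h.1] <;>
        nlinarith [sq_nonneg ‖x.1‖, sq_nonneg ‖x.2‖]
    have h3 : min 1 c * ‖x.1‖ ^ 2 ≤ 1 * ‖x.1‖ ^ 2 := by gcongr; exact min_le_left _ _
    have h4 : min 1 c * ‖x.2‖ ^ 2 ≤ c * ‖x.2‖ ^ 2 := by gcongr; exact min_le_right _ _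
    have h5 := mul_le_mul_of_nonneg_left h2 (lt_min one_pos hc).le
    linarith
  · rw [hA, hA, real_inner_comm, ← hin, ← hin]
    simp_rw [mul_comm (x.2 _)]
  · rw [hA, ← hin]
    rfl

lemma exists_energyForm (hΩ : IsLipschitzDomain Ω) {B : BoundaryOp n} (hB : B.Regular Ω) :
    ∃ A : (L2v Ω × L2b Ω) →L[ℝ] (L2v Ω × L2b Ω) →L[ℝ] ℝ,
      ∀ G h G' h', energy Ω B G h G' h' = A (G, h) (G', h') := by
  let p₁ := ContinuousLinearMap.fst ℝ (L2v Ω) (L2b Ω)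
  cases B with
  | dirichlet => exact ⟨(innerForm (L2v Ω)).bilinearComp p₁ p₁, fun _ _ _ _ => rfl⟩
  | neumann => exact ⟨(innerForm (L2v Ω)).bilinearComp p₁ p₁, fun _ _ _ _ => rfl⟩
  | robin κ =>
    obtain ⟨A, -, -, -, -, hA⟩ := exists_robinForm hΩ hB
    exact ⟨A, hA⟩

/-! ### Translation by a harmonic extension -/

lemma Admissible.add (hΩ : IsLipschitzDomain Ω) {B : BoundaryOp n} {g g' h h' : L2b Ω}
    {f f' : L2 Ω} {G G' : L2v Ω} (H : Admissible Ω B g f G h) (H' : Admissible Ω B g' f' G' h') :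
    Admissible Ω B (g + g') (f + f') (G + G') (h + h') := by
  cases B with
  | dirichlet =>
    obtain ⟨H1, rfl⟩ := H
    obtain ⟨H2, rfl⟩ := H'
    rw [hΩ.hasTrace_iff] at H1 H2
    exact ⟨(hΩ.hasTrace_iff _ _ _).2 (add_mem H1 H2), rfl⟩
  | neumann =>
    simp only [Admissible, hΩ.isH1_iff] at *
    exact add_mem H H'
  | robin κ =>
    simp only [Admissible, hΩ.hasTrace_iff] at *
    exact add_mem H H'

lemma Admissible.neg (hΩ : IsLipschitzDomain Ω) {B : BoundaryOp n} {g h : L2b Ω}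
    {f : L2 Ω} {G : L2v Ω} (H : Admissible Ω B g f G h) : Admissible Ω B (-g) (-f) (-G) (-h) := by
  cases B with
  | dirichlet =>
    obtain ⟨H1, rfl⟩ := H
    rw [hΩ.hasTrace_iff] at H1
    exact ⟨(hΩ.hasTrace_iff _ _ _).2 (neg_mem H1), rfl⟩
  | neumann =>
    simp only [Admissible, hΩ.isH1_iff] at *
    exact neg_mem H
  | robin κ =>
    simp only [Admissible, hΩ.hasTrace_iff] at *
    exact neg_mem H

lemma IsHarmonicExtension.neg (hΩ : IsLipschitzDomain Ω) {B : BoundaryOp n} (hB : B.Regular Ω)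
    {g : L2b Ω} {z : L2 Ω} (H : IsHarmonicExtension Ω B g z) :
    IsHarmonicExtension Ω B (-g) (-z) := by
  obtain ⟨A, hA⟩ := exists_energyForm hΩ hB
  obtain ⟨G, h, h1, h2⟩ := H
  refine ⟨-G, -h, h1.neg hΩ, fun φ Gφ η hφ => ?_⟩
  have := h2 φ Gφ η hφ
  rw [hA] at this ⊢
  rw [← Prod.neg_mk, map_neg, neg_apply, this, inner_neg_left]

/-- Adding `z` cancels in the difference from the initial value and adds the constant `⟨g', η⟩` to
the energy, whose integral over `(0, t)` is `t ⟨g', η⟩`. -/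
lemma IsHeatSolution.add_harmonic (hΩ : IsLipschitzDomain Ω) {B : BoundaryOp n}
    (hB : B.Regular Ω) {g g' : L2b Ω} {u z : L2 Ω} {v : ℝ → L2 Ω}
    (hv : IsHeatSolution Ω B g u v) (hz : IsHarmonicExtension Ω B g' z) :
    IsHeatSolution Ω B (g + g') (u + z) (fun t => v t + z) := by
  obtain ⟨A, hA⟩ := exists_energyForm hΩ hB
  obtain ⟨h1, h2, G, h, h3, h4, h5⟩ := hv
  obtain ⟨Gz, hz', hz1, hz2⟩ := hz
  refine ⟨by simp only [h1], h2.add continuousOn_const, fun t => G t + Gz, fun t => h t + hz',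
    fun T hT => ⟨(h3 T hT).1.add (memLp_const _), (h3 T hT).2.add (memLp_const _)⟩, ?_, ?_⟩
  · filter_upwards [h4] with t ht using ht.add hΩ hz1
  · intro φ Gφ η hφ t ht
    have e1 := h5 φ Gφ η hφ t ht
    have e2 := hz2 φ Gφ η hφ
    simp only [hA] at e1 e2 ⊢
    have hint : IntervalIntegrable (fun τ => A (G τ, h τ) (Gφ, η)) volume 0 t := by
      rw [intervalIntegrable_iff_integrableOn_Ioc_of_le ht]
      exact (A.flip (Gφ, η)).integrable_comp
        ((integrableOn_of_memLp_two (fun T hT => (h3 T hT).1) t).prodMk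
          (integrableOn_of_memLp_two (fun T hT => (h3 T hT).2) t))
    have e3 : ∀ τ, A (G τ + Gz, h τ + hz') (Gφ, η) = A (G τ, h τ) (Gφ, η) + inner ℝ g' η := by
      intro τ
      rw [← e2, ← Prod.mk_add_mk, map_add, add_apply]
    simp_rw [e3]
    rw [intervalIntegral.integral_add hint intervalIntegrable_const,
      intervalIntegral.integral_const, inner_add_left, inner_add_left, inner_add_left, smul_eq_mul]
    linarith

lemma isHeatSolution_iff_sub (hΩ : IsLipschitzDomain Ω) {B : BoundaryOp n} (hB : B.Regular Ω)
    {g : L2b Ω} {u z : L2 Ω} (hz : IsHarmonicExtension Ω B g z) (v : ℝ → L2 Ω) :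
    IsHeatSolution Ω B g u v ↔ IsHeatSolution Ω B 0 (u - z) (fun t => v t - z) := by
  constructor
  · intro h
    simpa [sub_eq_add_neg] using h.add_harmonic hΩ hB (hz.neg hΩ hB)
  · intro h
    simpa using h.add_harmonic hΩ hB hz

/-! ### The homogeneous problems as abstract evolution equations -/

/-- The homogeneous heat problem is well posed: solutions are unique, and exist for data in the
spectral space, where moreover the fractional integral converges. -/
def WellPosed (Ω : Set (E n)) (B : BoundaryOp n) : Prop :=
  (∀ u w w', IsHeatSolution Ω B 0 u w → IsHeatSolution Ω B 0 u w' → EqOn w w' (Ici 0)) ∧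
  ∀ s ∈ Ioo (0 : ℝ) 1, ∀ u, MemSpectral Ω B (2 * s) u →
    ∃ w f, IsHeatSolution Ω B 0 u w ∧ HasFracIntegral s w f

/-- The boundary condition enters only through the choice of `K`, `a` and `D`. Coercivity is
required on the energy parts alone. -/
lemma wellPosed_of_isEvolution {K : Type*} [NormedAddCommGroup K] [NormedSpace ℝ K]
    [CompleteSpace K] {B : BoundaryOp n} {a : K →L[ℝ] K →L[ℝ] ℝ} {D : Submodule ℝ (L2 Ω × K)}
    (hD : IsClosed (D : Set (L2 Ω × K))) {c : ℝ} (hc : 0 < c) (hco : ∀ x, c * ‖x‖ ^ 2 ≤ a x x)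
    (hsymm : ∀ x y, a x y = a y x)
    (hsol : ∀ u w, IsHeatSolution Ω B 0 u w ↔ IsEvolution a D u w)
    (heig : ∀ μ φ, IsEigenfunction Ω B μ φ →
      ∃ k, (φ, k) ∈ D ∧ ∀ p ∈ D, a k p.2 = μ * inner ℝ φ p.1) : WellPosed Ω B := by
  have hpos : ∀ x, 0 ≤ a x x := fun x => (by positivity : 0 ≤ c * ‖x‖ ^ 2).trans (hco x)
  refine ⟨fun u w w' h h' => ((hsol _ _).1 h).unique hsymm hpos ((hsol _ _).1 h'), ?_⟩
  rintro s hs u ⟨b, lam, hb, -, -, hsum⟩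
  choose k hk hk' using fun m => heig _ _ (hb m)
  have hE : IsEigenbasis a D b k lam := ⟨hk, hk'⟩
  have hl := hE.nonneg hpos
  obtain ⟨f, hf⟩ := tendsto_frac_semigroup (b := b) (u := u) hs hl
    (by simpa only [real_inner_comm u] using hsum)
  refine ⟨semigroup b lam u, (Real.Gamma (-s))⁻¹ • f,
    (hsol _ _).2 (hE.isEvolution_semigroup hD hc hco u), ?_, ?_⟩
  · intro ε hε
    rw [semigroup_zero]
    exact integrableOn_frac_semigroup hs.1 hl u hε
  · rw [semigroup_zero]
    exact hf.const_smul _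

lemma innerForm_symm (F : Type*) [NormedAddCommGroup F] [InnerProductSpace ℝ F] (x y : F) :
    innerForm F x y = innerForm F y x := by
  rw [innerForm_apply, innerForm_apply, real_inner_comm]

lemma innerForm_coercive (F : Type*) [NormedAddCommGroup F] [InnerProductSpace ℝ F] (x : F) :
    1 * ‖x‖ ^ 2 ≤ innerForm F x x := by
  rw [innerForm_apply, real_inner_self_eq_norm_sq, one_mul]

/-- With datum `0` the solution class and the test class coincide: both are the preimage `D` of the
closed trace space under `(f, G) ↦ (f, G, 0)`. -/
lemma wellPosed_dirichlet (hΩ : IsLipschitzDomain Ω) : WellPosed Ω .dirichlet := by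
  let ι : (L2 Ω × L2v Ω) →L[ℝ] (L2 Ω × L2v Ω × L2b Ω) :=
    (ContinuousLinearMap.fst ℝ _ _).prod ((ContinuousLinearMap.snd ℝ _ _).prod 0)
  let D : Submodule ℝ (L2 Ω × L2v Ω) := hΩ.traceSpace.comap ι.toLinearMap
  have hD : ∀ f G, (f, G) ∈ D ↔ HasTrace Ω f G 0 := fun f G => (hΩ.hasTrace_iff f G 0).symm
  refine wellPosed_of_isEvolution (a := innerForm (L2v Ω)) (D := D)
    ((Submodule.isClosed_topologicalClosure _).preimage ι.continuous) one_pos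
    (innerForm_coercive _) (innerForm_symm _) (fun u w => ?_) ?_
  · constructor
    · rintro ⟨h1, h2, G, h, h3, h4, h5⟩
      refine ⟨h1, h2, G, fun T hT => (h3 T hT).1, ?_, fun p hp t ht => ?_⟩
      · filter_upwards [h4] with t ht
        obtain ⟨ht, h0⟩ := ht
        exact (hD _ _).2 (h0 ▸ ht)
      · have := h5 p.1 p.2 0 ⟨(hD _ _).1 hp, fun _ => rfl⟩ t ht
        simpa [energy] using this
    · rintro ⟨h1, h2, y, h3, h4, h5⟩
      refine ⟨h1, h2, y, fun _ => 0, fun T hT => ⟨h3 T hT, MemLp.zero⟩, ?_, ?_⟩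
      · filter_upwards [h4] with t ht
        exact ⟨(hD _ _).1 ht, rfl⟩
      · rintro φ Gφ η ⟨hφ, h0⟩ t ht
        rw [h0 rfl] at hφ
        have := h5 (φ, Gφ) ((hD _ _).2 hφ) t ht
        simpa [energy] using this
  · rintro μ φ ⟨G, h, ⟨h1, h0⟩, h2⟩
    exact ⟨G, (hD _ _).2 (h0 ▸ h1), fun p hp => h2 p.1 p.2 0 ⟨(hD _ _).1 hp, fun _ => rfl⟩⟩

lemma isTest_neumann_smooth (hΩ : IsLipschitzDomain Ω) (ψ : smoothFunctions n) :
    IsTest Ω .neumann (hΩ.smoothPair ψ).1 (hΩ.smoothPair ψ).2 (hΩ.smoothTriple ψ).2.2 :=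
  ⟨(hΩ.hasTrace_iff _ _ _).2 (Submodule.le_topologicalClosure _ ⟨ψ, rfl⟩), nofun⟩

/-- Solutions carry no trace while test functions do. Both sides of the weak equation ignore the
trace and are continuous in the pair (function, gradient), so smooth tests suffice by density and no
trace theorem is needed. -/
lemma wellPosed_neumann (hΩ : IsLipschitzDomain Ω) : WellPosed Ω .neumann := by
  have hdense : ∀ {f f' : L2 Ω × L2v Ω → ℝ}, Continuous f → Continuous f' →
      (∀ ψ, f (hΩ.smoothPair ψ) = f' (hΩ.smoothPair ψ)) → ∀ p ∈ hΩ.sobolevSpace, f p = f' p := by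
    intro f f' hf hf' h p hp
    refine closure_minimal (t := {p | f p = f' p}) ?_ (isClosed_eq hf hf') hp
    rintro _ ⟨ψ, rfl⟩
    exact h ψ
  refine wellPosed_of_isEvolution (a := innerForm (L2v Ω)) (D := hΩ.sobolevSpace)
    (Submodule.isClosed_topologicalClosure _) one_pos
    (innerForm_coercive _) (innerForm_symm _) (fun u w => ?_) ?_
  · constructor
    · rintro ⟨h1, h2, G, h, h3, h4, h5⟩
      refine ⟨h1, h2, G, fun T hT => (h3 T hT).1, ?_, fun p hp t ht => ?_⟩
      · filter_upwards [h4] with t ht using (hΩ.isH1_iff _ _).1 ht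
      · have hG := intervalIntegrable_of_memLp_two (fun T hT => (h3 T hT).1) ht
        -- Moving the time integral inside the form makes continuity in the test pair evident.
        have hcomm : ∀ k : L2v Ω, ∫ τ in (0 : ℝ)..t, innerForm (L2v Ω) (G τ) k =
            innerForm (L2v Ω) (∫ τ in (0 : ℝ)..t, G τ) k := fun k =>
          ((innerForm (L2v Ω)).flip k).intervalIntegral_comp_comm hG
        refine hdense (f := fun p => inner ℝ (w t) p.1 - inner ℝ u p.1 +
          ∫ τ in (0 : ℝ)..t, innerForm (L2v Ω) (G τ) p.2) (f' := fun _ => 0) ?_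
          continuous_const (fun ψ => ?_) p hp
        · simp_rw [hcomm]
          fun_prop
        · have := h5 _ _ _ (isTest_neumann_smooth hΩ ψ) t ht
          simpa [energy] using this
    · rintro ⟨h1, h2, y, h3, h4, h5⟩
      refine ⟨h1, h2, y, fun _ => 0, fun T hT => ⟨h3 T hT, MemLp.zero⟩, ?_, ?_⟩
      · filter_upwards [h4] with t ht using (hΩ.isH1_iff _ _).2 ht
      · rintro φ Gφ η ⟨hφ, -⟩ t ht
        have := h5 (φ, Gφ) (hΩ.sobolevSpace_of_traceSpace ((hΩ.hasTrace_iff _ _ _).1 hφ)) t ht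
        simpa [energy] using this
  · rintro μ φ ⟨G, h, h1, h2⟩
    refine ⟨G, (hΩ.isH1_iff _ _).1 h1, hdense (by fun_prop) (by fun_prop) fun ψ => ?_⟩
    exact h2 _ _ _ (isTest_neumann_smooth hΩ ψ)

/-- The trace is now part of the energy component, so `D` is the trace space itself, and it is also
the test space. -/
lemma wellPosed_robin (hΩ : IsLipschitzDomain Ω) {κ : E n → ℝ}
    (hκ : (BoundaryOp.robin κ).Regular Ω) : WellPosed Ω (.robin κ) := by
  obtain ⟨A, c, hc, hco, hsymm, hA⟩ := exists_robinForm hΩ hκ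
  refine wellPosed_of_isEvolution (a := A) (D := hΩ.traceSpace)
    (Submodule.isClosed_topologicalClosure _) hc hco hsymm (fun u w => ?_) ?_
  · constructor
    · rintro ⟨h1, h2, G, h, h3, h4, h5⟩
      refine ⟨h1, h2, fun t => (G t, h t), fun T hT => ?_, ?_, fun p hp t ht => ?_⟩
      · exact memLp_prod_iff.2 (h3 T hT)
      · filter_upwards [h4] with t ht using (hΩ.hasTrace_iff _ _ _).1 ht
      · have := h5 p.1 p.2.1 p.2.2 ⟨(hΩ.hasTrace_iff _ _ _).2 hp, nofun⟩ t ht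
        simpa [hA] using this
    · rintro ⟨h1, h2, y, h3, h4, h5⟩
      refine ⟨h1, h2, fun t => (y t).1, fun t => (y t).2,
        fun T hT => memLp_prod_iff.1 (h3 T hT), ?_, ?_⟩
      · filter_upwards [h4] with t ht using (hΩ.hasTrace_iff _ _ _).2 ht
      · rintro φ Gφ η ⟨hφ, -⟩ t ht
        have := h5 (φ, Gφ, η) ((hΩ.hasTrace_iff _ _ _).1 hφ) t ht
        simpa [hA] using this
  · rintro μ φ ⟨G, h, h1, h2⟩
    refine ⟨(G, h), (hΩ.hasTrace_iff _ _ _).1 h1, fun p hp => ?_⟩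
    have := h2 p.1 p.2.1 p.2.2 ⟨(hΩ.hasTrace_iff _ _ _).2 hp, nofun⟩
    rwa [hA] at this

lemma wellPosed (hΩ : IsLipschitzDomain Ω) {B : BoundaryOp n} (hB : B.Regular Ω) :
    WellPosed Ω B := by
  cases B with
  | dirichlet => exact wellPosed_dirichlet hΩ
  | neumann => exact wellPosed_neumann hΩ
  | robin κ => exact wellPosed_robin hΩ hB

/-! ### The fractional operators -/

lemma hasFracIntegral_sub_const {s : ℝ} (v : ℝ → L2 Ω) (z f : L2 Ω) :
    HasFracIntegral s (fun t => v t - z) f ↔ HasFracIntegral s v f := by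
  simp [HasFracIntegral]

lemma isNonhomFrac_iff (hΩ : IsLipschitzDomain Ω) {B : BoundaryOp n} (hB : B.Regular Ω) {s : ℝ}
    {g : L2b Ω} {u z : L2 Ω} (hz : IsHarmonicExtension Ω B g z) (f : L2 Ω) :
    IsNonhomFrac Ω B g s u f ↔ IsFracLaplacian Ω B s (u - z) f := by
  constructor
  · rintro ⟨v, hv, hf⟩
    exact ⟨_, (isHeatSolution_iff_sub hΩ hB hz v).1 hv, (hasFracIntegral_sub_const v z f).2 hf⟩
  · rintro ⟨w, hw, hf⟩
    refine ⟨fun t => w t + z, (isHeatSolution_iff_sub hΩ hB hz _).2 (by simpa using hw), ?_⟩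
    rw [← hasFracIntegral_sub_const _ z]
    simpa using hf

/-- The null set of exceptional `x` depends on `t`; joint measurability and Fubini exchange the
quantifiers. Time `0` is kept apart, since the product measure does not see it. -/
lemma Represents.ae_ae_sub_eq {v w : ℝ → L2 Ω} {V W : ℝ → E n → ℝ} {z : L2 Ω}
    (hV : Represents V v) (hW : Represents W w) (h : ∀ t ≥ (0 : ℝ), v t = w t + z) :
    ∀ᵐ x ∂(volume.restrict Ω), V 0 x = W 0 x + z x ∧
      ∀ᵐ t ∂(volume.restrict (Ioi (0 : ℝ))), V t x = W t x + z x := by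
  have hpt : ∀ t ≥ (0 : ℝ), ∀ᵐ x ∂(volume.restrict Ω), V t x = W t x + z x := by
    intro t ht
    filter_upwards [hV.2 t ht, hW.2 t ht, Lp.coeFn_add (w t) z] with x h1 h2 h3
    rw [h1, h2, h t ht, h3]
    rfl
  refine (hpt 0 le_rfl).and ?_
  set μ := volume.restrict (Ioi (0 : ℝ))
  set ν := volume.restrict Ω
  have hz : AEStronglyMeasurable (fun p : ℝ × E n => z p.2) (μ.prod ν) :=
    (Lp.aestronglyMeasurable z).comp_snd
  have hnull : NullMeasurableSet {p : ℝ × E n | V p.1 p.2 = W p.1 p.2 + z p.2} (μ.prod ν) :=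
    nullMeasurableSet_eq_fun hV.1.aemeasurable (hW.1.aemeasurable.add hz.aemeasurable)
  have hprod : ∀ᵐ p ∂(μ.prod ν), V p.1 p.2 = W p.1 p.2 + z p.2 := by
    -- The equality set is only null measurable, so Fubini is applied to a measurable subset that
    -- differs from it by a null set.
    obtain ⟨S, hS, hSm, hSae⟩ := hnull.exists_measurable_subset_ae_eq
    refine Eventually.mono ((Measure.ae_prod_mem_iff_ae_ae_mem hSm).2 ?_) fun p hp => hS hp
    filter_upwards [Measure.ae_ae_of_ae_prod hSae, ae_restrict_mem measurableSet_Ioi] with t h1 ht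
    filter_upwards [h1, hpt t (le_of_lt ht)] with x h2 h3
    exact (Iff.of_eq h2).2 h3
  have hswap := (Measure.measurePreserving_swap (μ := ν) (ν := μ)).quasiMeasurePreserving.ae hprod
  exact Measure.ae_ae_of_ae_prod hswap

lemma integrableOn_iff_and_fracIntegralAt_eq {s c : ℝ} {V W : ℝ → E n → ℝ} {x : E n}
    (h0 : V 0 x = W 0 x + c)
    (h : ∀ᵐ t ∂(volume.restrict (Ioi (0 : ℝ))), V t x = W t x + c) {ε : ℝ} (hε : 0 ≤ ε) :
    (IntegrableOn (fun t => (V t x - V 0 x) / t ^ (1 + s)) (Ioi ε) ↔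
      IntegrableOn (fun t => (W t x - W 0 x) / t ^ (1 + s)) (Ioi ε)) ∧
    fracIntegralAt s V ε x = fracIntegralAt s W ε x := by
  have hae : (fun t => (V t x - V 0 x) / t ^ (1 + s)) =ᵐ[volume.restrict (Ioi ε)]
      fun t => (W t x - W 0 x) / t ^ (1 + s) := by
    filter_upwards [ae_restrict_of_ae_restrict_of_subset (Ioi_subset_Ioi hε) h] with t ht
    rw [ht, h0, add_sub_add_right_eq_sub]
  exact ⟨integrable_congr hae, by rw [fracIntegralAt, fracIntegralAt, integral_congr_ae hae]⟩

end FracHeat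

end

theorem lemma5p1 {n : ℕ} (hn : 1 ≤ n) (Ω : Set (E n)) (hΩ : IsLipschitzDomain Ω)
    (B : BoundaryOp n) (hB : B.Regular Ω) (s : ℝ) (hs : s ∈ Ioo (0 : ℝ) 1)
    (g : L2b Ω) (u z : L2 Ω)
    (hu : MemSobolev Ω (2 * s) u) (hug : HasBoundaryValue Ω B (2 * s) u g)
    (hz : MemSobolev Ω (2 * s) z) (hzg : IsHarmonicExtension Ω B g z) :
    -- each of the two heat problems has at most one solution, and they differ by the shift by `z`
    (∀ v v', IsHeatSolution Ω B g u v → IsHeatSolution Ω B g u v' → EqOn v v' (Ici 0)) ∧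
    (∀ w w', IsHeatSolution Ω B 0 (u - z) w → IsHeatSolution Ω B 0 (u - z) w' →
      EqOn w w' (Ici 0)) ∧
    (∀ v, IsHeatSolution Ω B g u v ↔ IsHeatSolution Ω B 0 (u - z) (fun t => v t - z)) ∧
    -- `L_g^s[u] = (-Δ_B)^s[u - z]` in `L²(Ω)`: one is defined iff the other is, with equal values
    (∀ f, IsNonhomFrac Ω B g s u f ↔ IsFracLaplacian Ω B s (u - z) f) ∧
    -- both are defined when `u - z` lies in `ℍ_B^{2s}(Ω)`
    (MemSpectral Ω B (2 * s) (u - z) →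
      ∃ f, IsNonhomFrac Ω B g s u f ∧ IsFracLaplacian Ω B s (u - z) f) ∧
    -- the identity also holds for the integrals taken pointwise, at almost every `x ∈ Ω`
    (∀ v w V W, IsHeatSolution Ω B g u v → IsHeatSolution Ω B 0 (u - z) w →
      Represents V v → Represents W w →
      ∀ᵐ x ∂(volume.restrict Ω), ∀ ε ≥ (0 : ℝ),
        (IntegrableOn (fun t => (V t x - V 0 x) / t ^ (1 + s)) (Ioi ε) ↔
          IntegrableOn (fun t => (W t x - W 0 x) / t ^ (1 + s)) (Ioi ε)) ∧
        fracIntegralAt s V ε x = fracIntegralAt s W ε x) := by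
  have hP := wellPosed hΩ hB
  have hshift := isHeatSolution_iff_sub (u := u) hΩ hB hzg
  have hfrac := fun f => isNonhomFrac_iff (s := s) (u := u) hΩ hB hzg f
  refine ⟨fun v v' hv hv' t ht => ?_, fun w w' hw hw' => hP.1 _ w w' hw hw', hshift, hfrac,
    fun hspec => ?_, fun v w V W hv hw hV hW => ?_⟩
  · exact sub_left_injective (hP.1 _ _ _ ((hshift v).1 hv) ((hshift v').1 hv') ht)
  · obtain ⟨w, f, hw, hf⟩ := hP.2 s hs _ hspec
    exact ⟨f, (hfrac f).2 ⟨w, hw, hf⟩, w, hw, hf⟩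
  · have hvw : ∀ t ≥ (0 : ℝ), v t = w t + z := fun t ht =>
      sub_eq_iff_eq_add.1 (hP.1 _ _ _ ((hshift v).1 hv) hw ht)
    filter_upwards [hV.ae_ae_sub_eq hW hvw] with x hx ε hε
    exact integrableOn_iff_and_fracIntegralAt_eq hx.1 hx.2 hε
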